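/- Let $T\ge 0$ and let $D_0([0,T],\mathbb{R})$ be the space of real-valued càdlàg paths $\omega=(\omega_t)_{t\in[0,T]}$ (right-continuous with left limits) with $\omega_0=0$, equipped with the Skorokhod topology, i.e. the topology of the metric $$d^\circ(x,y)=\inf_{\lambda}\max\Big\{\sup_{0\le s<t\le T}\Big|\log\frac{\lambda(t)-\lambda(s)}{t-s}\Big|,\ \sup_{0\le t\le T}|x_t-y_{\lambda(t)}|\Big\},$$ where $\lambda$ runs over the strictly increasing continuous maps of $[0,T]$ onto itself, and with its Borel $\sigma$-algebra. Let $\mathscr{P}$ be any set of Borel probability measures on $D_0([0,T],\mathbb{R})$, and for a nonnegative random variable $X$ put $\mathbb{E}[X]:=\sup_{P\in\mathscr{P}}E_P[X]\in[0,\infty]$. Suppose that: (i) there are constants $C_1>0$ and $a>0$ such that $\mathbb{E}[|\omega_t-\omega_s|]\le C_1|t-s|^{a}$ for all $s,t\in[0,T]$; (ii) there are constants $C_2>0$, $r>0$ and $p,q\ge 0$ with $p+q>0$ such that $\mathbb{E}\big[|\omega_t-\omega_u|^{p}\,|\omega_u-\omega_s|^{q}\big]\le C_2|t-s|^{1+r}$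 for all $0\le s\le u\le t\le T$ (with the convention $x^0=1$ for all $x\ge 0$). Then $\mathscr{P}$ is weakly relatively compact: its closure in the space of all Borel probability measures on $D_0([0,T],\mathbb{R})$, with the topology of weak convergence, is compact. -/

import Mathlib

open MeasureTheory Set Filter Topology
open scoped ENNReal

/-- A function on `[0, T]` is càdlàg if it is right-continuous with (finite) left limits. At the
left end point the left-limit condition is void (`𝓝[<] 0 = ⊥` in `[0, T]`), and at the right end
point the right-continuity condition is void. -/
def IsCadlag {T : ℝ} (f : Icc (0 : ℝ) T → ℝ) : Prop :=
  ∀ t : Icc (0 : ℝ) T, Tendsto f (𝓝[>] t) (𝓝 (f t)) ∧ ∃ l : ℝ, Tendsto f (𝓝[<] t) (𝓝 l)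

/-- The path space `D₀([0, T], ℝ)` of real-valued càdlàg paths on `[0, T]` that start at `0`. -/
structure CadlagPath (T : ℝ) where
  /-- the path -/
  toFun : Icc (0 : ℝ) T → ℝ
  /-- it is càdlàg -/
  isCadlag : IsCadlag toFun
  /-- it vanishes at time `0` -/
  map_zero : ∀ t : Icc (0 : ℝ) T, (t : ℝ) = 0 → toFun t = 0

instance (T : ℝ) : CoeFun (CadlagPath T) (fun _ => Icc (0 : ℝ) T → ℝ) := ⟨CadlagPath.toFun⟩

/-- The increasing bijections of `[0, T]` onto itself, i.e. the strictly increasing continuous maps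
of `[0, T]` onto itself. -/
abbrev TimeChange (T : ℝ) : Type := Icc (0 : ℝ) T ≃o Icc (0 : ℝ) T

/-- `‖l‖° = sup_{s < t} |log ((l t - l s) / (t - s))|`. -/
noncomputable def TimeChange.logNorm {T : ℝ} (l : TimeChange T) : ℝ≥0∞ :=
  ⨆ (s : Icc (0 : ℝ) T) (t : Icc (0 : ℝ) T) (_ : s < t),
    ENNReal.ofReal |Real.log (((l t : ℝ) - (l s : ℝ)) / ((t : ℝ) - (s : ℝ)))|

/-- The uniform distance `sup_t |x t - y (l t)|`. -/
noncomputable def CadlagPath.supDist {T : ℝ} (x y : CadlagPath T) (l : TimeChange T) : ℝ≥0∞ :=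
  ⨆ t : Icc (0 : ℝ) T, ENNReal.ofReal |x t - y (l t)|

/-- Billingsley's form of the Skorokhod distance,
`d°(x, y) = inf_l max (‖l‖°, sup_t |x t - y (l t)|)`. -/
noncomputable def CadlagPath.skorokhodDist {T : ℝ} (x y : CadlagPath T) : ℝ≥0∞ :=
  ⨅ l : TimeChange T, max l.logNorm (x.supDist y l)

theorem TimeChange.le_logNorm {T : ℝ} (l : TimeChange T) {s t : Icc (0 : ℝ) T} (hst : s < t) :
    ENNReal.ofReal |Real.log (((l t : ℝ) - (l s : ℝ)) / ((t : ℝ) - (s : ℝ)))| ≤ l.logNorm := by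
  refine le_iSup_of_le s (le_iSup_of_le t ?_)
  exact le_iSup (fun _ : s < t =>
    ENNReal.ofReal |Real.log (((l t : ℝ) - (l s : ℝ)) / ((t : ℝ) - (s : ℝ)))|) hst

theorem TimeChange.logNorm_refl (T : ℝ) : TimeChange.logNorm (OrderIso.refl (Icc (0 : ℝ) T)) = 0 := by
  simp only [TimeChange.logNorm, ENNReal.iSup_eq_zero]
  intro s t hst
  have h : (t : ℝ) - s ≠ 0 := sub_ne_zero.2 (ne_of_gt hst)
  simp [h]

theorem TimeChange.logNorm_symm_le {T : ℝ} (l : TimeChange T) :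
    TimeChange.logNorm (l.symm : TimeChange T) ≤ l.logNorm := by
  refine iSup_le fun s => iSup_le fun t => iSup_le fun hst => ?_
  have hst' : l.symm s < l.symm t := l.symm.strictMono hst
  refine le_trans (le_of_eq ?_) (l.le_logNorm hst')
  rw [OrderIso.apply_symm_apply, OrderIso.apply_symm_apply, ← inv_div, Real.log_inv, abs_neg]

theorem TimeChange.logNorm_trans_le {T : ℝ} (l m : TimeChange T) :
    TimeChange.logNorm (l.trans m : TimeChange T) ≤ l.logNorm + m.logNorm := by
  refine iSup_le fun s => iSup_le fun t => iSup_le fun hst => ?_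
  have h1 : l s < l t := l.strictMono hst
  have h2 : m (l s) < m (l t) := m.strictMono h1
  have e1 : (0 : ℝ) < (t : ℝ) - s := sub_pos.2 hst
  have e2 : (0 : ℝ) < (l t : ℝ) - l s := sub_pos.2 h1
  have e3 : (0 : ℝ) < (m (l t) : ℝ) - m (l s) := sub_pos.2 h2
  have key : Real.log (((m (l t) : ℝ) - m (l s)) / ((t : ℝ) - s))
      = Real.log (((l t : ℝ) - l s) / ((t : ℝ) - s))
        + Real.log (((m (l t) : ℝ) - m (l s)) / ((l t : ℝ) - l s)) := by
    rw [← Real.log_mul (div_pos e2 e1).ne' (div_pos e3 e2).ne']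
    congr 1
    field_simp
  simp only [OrderIso.trans_apply]
  rw [key]
  calc _ ≤ ENNReal.ofReal (|Real.log (((l t : ℝ) - l s) / ((t : ℝ) - s))|
        + |Real.log (((m (l t) : ℝ) - m (l s)) / ((l t : ℝ) - l s))|) :=
        ENNReal.ofReal_le_ofReal (abs_add_le _ _)
    _ = _ := ENNReal.ofReal_add (abs_nonneg _) (abs_nonneg _)
    _ ≤ _ := add_le_add (l.le_logNorm hst) (m.le_logNorm h1)

namespace CadlagPath

theorem ext_toFun {T : ℝ} {x y : CadlagPath T} (h : ∀ t, x t = y t) : x = y := by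
  cases x; cases y
  congr
  exact funext h

theorem skorokhodDist_self {T : ℝ} (x : CadlagPath T) : x.skorokhodDist x = 0 := by
  refine le_antisymm (iInf_le_of_le (OrderIso.refl _) ?_) bot_le
  simp [TimeChange.logNorm_refl, supDist]

theorem skorokhodDist_comm_le {T : ℝ} (x y : CadlagPath T) :
    x.skorokhodDist y ≤ y.skorokhodDist x := by
  refine le_iInf fun l => iInf_le_of_le l.symm (max_le_max l.logNorm_symm_le ?_)
  refine iSup_le fun t => le_iSup_of_le (l.symm t) ?_
  rw [OrderIso.apply_symm_apply, abs_sub_comm]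

theorem skorokhodDist_triangle {T : ℝ} (x y z : CadlagPath T) :
    x.skorokhodDist z ≤ x.skorokhodDist y + y.skorokhodDist z := by
  refine ENNReal.le_iInf_add_iInf fun l m => iInf_le_of_le (l.trans m) (max_le ?_ ?_)
  · exact (TimeChange.logNorm_trans_le l m).trans (add_le_add (le_max_left _ _) (le_max_left _ _))
  · refine iSup_le fun t => ?_
    refine le_trans ?_ (add_le_add (le_max_right _ _) (le_max_right _ _))
    refine le_trans ?_ (add_le_add (le_iSup_of_le t le_rfl) (le_iSup_of_le (l t) le_rfl))
    rw [← ENNReal.ofReal_add (abs_nonneg _) (abs_nonneg _)]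
    refine ENNReal.ofReal_le_ofReal ?_
    simp only [OrderIso.trans_apply]
    exact abs_sub_le _ _ _

/-- A time change with small `‖·‖°` is uniformly close to the identity. -/
theorem abs_timeChange_sub_le {T : ℝ} (l : TimeChange T) {ε : ℝ} (hε : 0 ≤ ε)
    (h : l.logNorm ≤ ENNReal.ofReal ε) (t : Icc (0 : ℝ) T) :
    (t : ℝ) * Real.exp (-ε) ≤ (l t : ℝ) ∧ (l t : ℝ) ≤ t * Real.exp ε := by
  have hT : (0 : ℝ) ≤ T := t.2.1.trans t.2.2
  let o : Icc (0 : ℝ) T := ⟨0, le_rfl, hT⟩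
  have ho : l o = o := by
    refine le_antisymm ?_ (show o ≤ l o from (l o).2.1)
    have h1 : o ≤ l.symm o := (l.symm o).2.1
    have h2 := l.monotone h1
    rwa [OrderIso.apply_symm_apply] at h2
  rcases eq_or_lt_of_le (show o ≤ t from t.2.1) with h0 | h0
  · rw [← h0, ho]
    simp [o]
  · have ht : (0 : ℝ) < t := h0
    have hlt : (0 : ℝ) < l t := by
      have h3 : l o < l t := l.strictMono h0
      rw [ho] at h3
      exact h3
    have hle : ENNReal.ofReal |Real.log (((l t : ℝ) - (l o : ℝ)) / ((t : ℝ) - (o : ℝ)))|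
        ≤ ENNReal.ofReal ε :=
      le_trans (l.le_logNorm h0) h
    rw [ENNReal.ofReal_le_ofReal_iff hε, ho] at hle
    simp only [o, sub_zero] at hle
    obtain ⟨ha, hb⟩ := abs_le.1 hle
    have hp := div_pos hlt ht
    rw [Real.le_log_iff_exp_le hp, le_div_iff₀ ht] at ha
    rw [Real.log_le_iff_le_exp hp, div_le_iff₀ ht] at hb
    constructor <;> linarith

theorem eq_of_skorokhodDist_eq_zero {T : ℝ} {x y : CadlagPath T} (h : x.skorokhodDist y = 0) :
    x = y := by
  have H : ∀ ε : ℝ, 0 < ε → ∃ l : TimeChange T,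
      l.logNorm ≤ ENNReal.ofReal ε ∧ ∀ t, |x t - y (l t)| ≤ ε := by
    intro ε hε
    have h1 : x.skorokhodDist y < ENNReal.ofReal ε := by rw [h]; exact ENNReal.ofReal_pos.2 hε
    obtain ⟨l, hl⟩ := iInf_lt_iff.1 h1
    refine ⟨l, (le_max_left _ _).trans hl.le, fun t => ?_⟩
    have h2 : ENNReal.ofReal |x t - y (l t)| ≤ ENNReal.ofReal ε :=
      (le_iSup_of_le t le_rfl).trans ((le_max_right _ _).trans hl.le)
    exact (ENNReal.ofReal_le_ofReal_iff hε.le).1 h2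
  refine ext_toFun fun t => ?_
  refine eq_of_forall_dist_le fun ε hε => ?_
  rw [Real.dist_eq]
  rcases eq_or_lt_of_le t.2.2 with htT | htT
  · obtain ⟨l, -, hl⟩ := H ε hε
    have hlt : l t = t := by
      have hmax : ∀ u : Icc (0 : ℝ) T, u ≤ t := fun u => by
        show (u : ℝ) ≤ t
        rw [htT]; exact u.2.2
      refine le_antisymm (hmax _) ?_
      have h2 := l.monotone (hmax (l.symm t))
      rwa [OrderIso.apply_symm_apply] at h2
    have := hl t
    rwa [hlt] at this
  · let e : Icc (0 : ℝ) T := ⟨T, t.2.1.trans t.2.2, le_rfl⟩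
    have hte : t < e := htT
    have hx : ∀ᶠ u in 𝓝[>] t, |x u - x t| < ε / 3 :=
      (x.isCadlag t).1 (Metric.ball_mem_nhds _ (by positivity))
    have hy : ∀ᶠ u in 𝓝[>] t, |y u - y t| < ε / 3 :=
      (y.isCadlag t).1 (Metric.ball_mem_nhds _ (by positivity))
    obtain ⟨b, hb, hsub⟩ := (mem_nhdsGT_iff_exists_Ioo_subset' hte).1 (hx.and hy)
    have htb : (t : ℝ) < b := hb
    have ht0 : (0 : ℝ) ≤ t := t.2.1
    let u : Icc (0 : ℝ) T := ⟨((t : ℝ) + b) / 2, by linarith, by linarith [b.2.2]⟩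
    have htu : (t : ℝ) < u := by simp only [u]; linarith
    have hub : (u : ℝ) < b := by simp only [u]; linarith
    have c1 : ∀ᶠ δ in 𝓝 (0 : ℝ), (u : ℝ) * Real.exp δ < b := by
      have : Tendsto (fun δ : ℝ => (u : ℝ) * Real.exp δ) (𝓝 0) (𝓝 ((u : ℝ) * Real.exp 0)) :=
        (by fun_prop : Continuous fun δ : ℝ => (u : ℝ) * Real.exp δ).tendsto 0
      rw [Real.exp_zero, mul_one] at this
      exact this.eventually_lt_const hub
    have c2 : ∀ᶠ δ in 𝓝 (0 : ℝ), (t : ℝ) < u * Real.exp (-δ) := by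
      have : Tendsto (fun δ : ℝ => (u : ℝ) * Real.exp (-δ)) (𝓝 0)
          (𝓝 ((u : ℝ) * Real.exp (-0))) :=
        (by fun_prop : Continuous fun δ : ℝ => (u : ℝ) * Real.exp (-δ)).tendsto 0
      rw [neg_zero, Real.exp_zero, mul_one] at this
      exact this.eventually_const_lt htu
    obtain ⟨η, hη, hball⟩ := Metric.eventually_nhds_iff.1 (c1.and c2)
    set δ := min (η / 2) (ε / 3) with hδ
    have hδ0 : 0 < δ := lt_min (by positivity) (by positivity)
    have hδη : dist δ 0 < η := by
      rw [Real.dist_eq, sub_zero, abs_of_pos hδ0]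
      exact (min_le_left _ _).trans_lt (by linarith)
    obtain ⟨l, hl1, hl2⟩ := H δ hδ0
    obtain ⟨k1, k2⟩ := abs_timeChange_sub_le l hδ0.le hl1 u
    obtain ⟨m1, m2⟩ := hball hδη
    have r1 : |x u - x t| < ε / 3 := (hsub ⟨htu, hub⟩).1
    have r2 : |y (l u) - y t| < ε / 3 := (hsub ⟨m2.trans_le k1, k2.trans_lt m1⟩).2
    have r3 : |x u - y (l u)| ≤ ε / 3 := (hl2 u).trans (min_le_right _ _)
    rw [abs_lt] at r1 r2
    rw [abs_le] at r3 ⊢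
    constructor <;> linarith [r1.1, r1.2, r2.1, r2.2, r3.1, r3.2]

/-- `D₀([0, T], ℝ)` carries the Skorokhod distance `d°`, and hence the Skorokhod topology. -/
noncomputable instance (T : ℝ) : EMetricSpace (CadlagPath T) where
  edist := skorokhodDist
  edist_self := skorokhodDist_self
  edist_comm x y := le_antisymm (skorokhodDist_comm_le x y) (skorokhodDist_comm_le y x)
  edist_triangle := skorokhodDist_triangle
  eq_of_edist_eq_zero := eq_of_skorokhodDist_eq_zero

/-- `D₀([0, T], ℝ)` carries the Borel σ-algebra of the Skorokhod topology. -/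
noncomputable instance (T : ℝ) : MeasurableSpace (CadlagPath T) := borel _

instance (T : ℝ) : BorelSpace (CadlagPath T) := ⟨rfl⟩

end CadlagPath

/-- The upper expectation `𝔼[X] = sup_{P ∈ Q} E_P[X]` of a nonnegative random variable `X`, with
values in `[0, ∞]`. -/
noncomputable def upperExpectation {Ω : Type*} [MeasurableSpace Ω]
    (Q : Set (ProbabilityMeasure Ω)) (X : Ω → ℝ≥0∞) : ℝ≥0∞ :=
  ⨆ P ∈ Q, ∫⁻ ω, X ω ∂(P : Measure Ω)

/-- A set of probability measures is weakly relatively compact if its closure in the topology of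
weak convergence (Mathlib's topology on `ProbabilityMeasure`) is compact. -/
def WeaklyRelativelyCompact {Ω : Type*} [MeasurableSpace Ω] [TopologicalSpace Ω]
    [OpensMeasurableSpace Ω] (Q : Set (ProbabilityMeasure Ω)) : Prop :=
  IsCompact (closure Q)

/-!
By Prokhorov's theorem it suffices to show that the measures in `Q` are tight. The Skorokhod space
is complete for `d°`, so tightness follows once, for each `η > 0`, finitely many paths can be found
whose `η`-neighbourhoods carry almost full mass uniformly in `Q`
(`isTightMeasureSet_of_forall_exists_finite`).

A suitable finite set consists of step paths on a fixed grid. A bounded path that oscillates by at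
most `η / 2` on each interval of a partition whose cut points are `δ` apart is `η`-close to one of
them: a time change with slopes near `1`, obtained by extending a Lipschitz function from the cut
points, moves the cut points to the grid (`CadlagPath.exists_finite_net`).

That most paths have such a partition is a chaining argument. By the bound on the product of
neighbouring increments, Markov's inequality and a union bound, with probability near `1` the
smaller one of any two consecutive increments along the dyadic grid of level `k` is at most `θ ^ k`,
for all `k ≥ K` (`measure_exists_dyadic_increments_gt_le`). Each dyadic point of level `k + 1` can
then be moved to a neighbour of level `k` at the cost `θ ^ (k + 1)`, and this can be done monotonically.
It follows that in each dyadic interval `[a, b]` of level `K` the path stays close to its value at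
`a` up to some switching time and close to its value at `b` from then on (`close_left_or_close_right`,
`exists_switching_time`). Two consecutive intervals cannot both have a large increment, so the
switching times with a large increment are separated. Together with the grid points away from them
they form the partition (`exists_sparse_partition_of_switching_times`). The bound on single
increments excludes large increments in the first and in the last interval and bounds the values on
the grid.
-/

/-! ### Time changes -/

namespace TimeChange

variable {T : ℝ}

theorem apply_eq_of_eq_zero (l : TimeChange T) {t : Icc (0 : ℝ) T} (ht : (t : ℝ) = 0) : l t = t := by
  have hmin : ∀ u : Icc (0 : ℝ) T, t ≤ u := fun u => by
    show (t : ℝ) ≤ u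
    rw [ht]; exact u.2.1
  refine le_antisymm ?_ (hmin _)
  simpa using l.monotone (hmin (l.symm t))

theorem apply_eq_of_eq_right (l : TimeChange T) {t : Icc (0 : ℝ) T} (ht : (t : ℝ) = T) :
    l t = t := by
  have hmax : ∀ u : Icc (0 : ℝ) T, u ≤ t := fun u => by
    show (u : ℝ) ≤ t
    rw [ht]; exact u.2.2
  refine le_antisymm (hmax _) ?_
  simpa using l.monotone (hmax (l.symm t))

theorem logNorm_le_ofReal_iff (l : TimeChange T) {κ : ℝ} (hκ : 0 ≤ κ) :
    l.logNorm ≤ ENNReal.ofReal κ ↔ ∀ s t : Icc (0 : ℝ) T, s < t →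
      Real.exp (-κ) * ((t : ℝ) - s) ≤ (l t : ℝ) - l s ∧
        (l t : ℝ) - l s ≤ Real.exp κ * ((t : ℝ) - s) := by
  simp only [logNorm, iSup_le_iff]
  refine forall_congr' fun s => forall_congr' fun t => forall_congr' fun hst => ?_
  have h1 : (0 : ℝ) < (t : ℝ) - s := sub_pos.2 hst
  have h2 : (0 : ℝ) < (l t : ℝ) - l s := sub_pos.2 (l.strictMono hst)
  have hp := div_pos h2 h1
  rw [ENNReal.ofReal_le_ofReal_iff hκ, abs_le, Real.le_log_iff_exp_le hp, le_div_iff₀ h1,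
    Real.log_le_iff_le_exp hp, div_le_iff₀ h1]

/-- A map with difference quotients in `[exp (-κ), exp κ]` that fixes the end points is a time
change. -/
theorem exists_of_quotient_bounds {κ : ℝ} (hκ : 0 ≤ κ) (f : Icc (0 : ℝ) T → ℝ)
    (h0 : ∀ t : Icc (0 : ℝ) T, (t : ℝ) = 0 → f t = 0)
    (h1 : ∀ t : Icc (0 : ℝ) T, (t : ℝ) = T → f t = T)
    (hf : ∀ s t : Icc (0 : ℝ) T, s < t → Real.exp (-κ) * ((t : ℝ) - s) ≤ f t - f s ∧
      f t - f s ≤ Real.exp κ * ((t : ℝ) - s)) :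
    ∃ l : TimeChange T, (∀ t, (l t : ℝ) = f t) ∧ l.logNorm ≤ ENNReal.ofReal κ := by
  have hmono : StrictMono f := fun s t hst => by
    have := (hf s t hst).1
    have h2 : 0 < Real.exp (-κ) * ((t : ℝ) - s) := mul_pos (Real.exp_pos _) (sub_pos.2 hst)
    linarith
  have hcont : Continuous f := by
    refine (LipschitzWith.of_dist_le_mul (K := (Real.exp κ).toNNReal) fun s t => ?_).continuous
    rw [Real.coe_toNNReal _ (Real.exp_pos _).le, Real.dist_eq, Subtype.dist_eq, Real.dist_eq]
    rcases lt_trichotomy s t with h | h | h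
    · rw [abs_sub_comm, abs_of_pos (sub_pos.2 (hmono h)), abs_sub_comm,
        abs_of_pos (sub_pos.2 (show (s : ℝ) < t from h))]
      exact (hf s t h).2
    · simp [h]
    · rw [abs_of_pos (sub_pos.2 (hmono h)), abs_of_pos (sub_pos.2 (show (t : ℝ) < s from h))]
      exact (hf t s h).2
  have hmem : ∀ t, f t ∈ Icc (0 : ℝ) T := fun t => by
    have hT : (0 : ℝ) ≤ T := t.2.1.trans t.2.2
    constructor
    · rw [← h0 ⟨0, le_rfl, hT⟩ rfl]
      exact hmono.monotone (show ((⟨0, le_rfl, hT⟩ : Icc (0 : ℝ) T) : ℝ) ≤ t from t.2.1)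
    · rw [← h1 ⟨T, hT, le_rfl⟩ rfl]
      exact hmono.monotone (show (t : ℝ) ≤ (⟨T, hT, le_rfl⟩ : Icc (0 : ℝ) T) from t.2.2)
  let g : Icc (0 : ℝ) T → Icc (0 : ℝ) T := fun t => ⟨f t, hmem t⟩
  have hg : StrictMono g := fun s t h => hmono h
  have hsurj : Function.Surjective g := fun y => by
    have hT : (0 : ℝ) ≤ T := y.2.1.trans y.2.2
    have : PreconnectedSpace (Icc (0 : ℝ) T) := Subtype.preconnectedSpace isPreconnected_Icc
    obtain ⟨t, ht⟩ := mem_range_of_exists_le_of_exists_ge hcont (c := (y : ℝ))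
      ⟨⟨0, le_rfl, hT⟩, by rw [h0 _ rfl]; exact y.2.1⟩ ⟨⟨T, hT, le_rfl⟩, by rw [h1 _ rfl]; exact y.2.2⟩
    exact ⟨t, Subtype.ext ht⟩
  refine ⟨hg.orderIsoOfSurjective g hsurj, fun t => rfl, ?_⟩
  rw [logNorm_le_ofReal_iff _ hκ]
  exact hf

theorem abs_apply_sub_le (l : TimeChange T) {κ : ℝ} (hκ : 0 ≤ κ) (hκ1 : κ ≤ 1)
    (h : l.logNorm ≤ ENNReal.ofReal κ) (t : Icc (0 : ℝ) T) : |(l t : ℝ) - t| ≤ T * 2 * κ := by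
  obtain ⟨h1, h2⟩ := CadlagPath.abs_timeChange_sub_le l hκ h t
  have h3 := Real.abs_exp_sub_one_le (x := κ) (by rwa [abs_of_nonneg hκ])
  have h4 := Real.abs_exp_sub_one_le (x := -κ) (by rwa [abs_neg, abs_of_nonneg hκ])
  rw [abs_neg] at h4
  rw [abs_of_nonneg hκ] at h3 h4
  have ht0 := t.2.1
  have htT : (t : ℝ) * (2 * κ) ≤ T * (2 * κ) := mul_le_mul_of_nonneg_right t.2.2 (by positivity)
  rw [abs_le] at h3 h4 ⊢
  constructor
  · nlinarith [mul_le_mul_of_nonneg_left h4.1 ht0]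
  · nlinarith [mul_le_mul_of_nonneg_left h3.2 ht0]

end TimeChange

/-! ### Càdlàg functions -/

theorem IsCadlag.comp_timeChange {T : ℝ} {f : Icc (0 : ℝ) T → ℝ} (hf : IsCadlag f)
    (l : TimeChange T) : IsCadlag fun t => f (l t) := by
  intro t
  have hl : Tendsto l (𝓝 t) (𝓝 (l t)) := l.continuous.tendsto t
  obtain ⟨h1, y, h2⟩ := hf (l t)
  refine ⟨h1.comp ?_, y, h2.comp ?_⟩
  · exact tendsto_nhdsWithin_iff.2 ⟨hl.mono_left nhdsWithin_le_nhds,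
      eventually_nhdsWithin_of_forall fun s hs => l.strictMono hs⟩
  · exact tendsto_nhdsWithin_iff.2 ⟨hl.mono_left nhdsWithin_le_nhds,
      eventually_nhdsWithin_of_forall fun s hs => l.strictMono hs⟩

/-- A uniform limit of càdlàg functions is càdlàg. -/
theorem isCadlag_of_forall_approx {T : ℝ} {f : Icc (0 : ℝ) T → ℝ}
    (h : ∀ ε > 0, ∃ g : Icc (0 : ℝ) T → ℝ, IsCadlag g ∧ ∀ t, |f t - g t| ≤ ε) : IsCadlag f := by
  intro t
  constructor
  · rw [Metric.tendsto_nhds]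
    intro ε hε
    obtain ⟨g, hg, hfg⟩ := h (ε / 4) (by positivity)
    filter_upwards [Metric.tendsto_nhds.1 (hg t).1 (ε / 4) (by positivity)] with s hs
    have h1 := hfg s
    have h2 := hfg t
    rw [Real.dist_eq, abs_lt] at *
    rw [abs_le] at h1 h2
    constructor <;> linarith
  · rcases eq_or_neBot (𝓝[<] t) with hbot | hne
    · exact ⟨0, by rw [hbot]; exact tendsto_bot⟩
    · refine cauchy_map_iff_exists_tendsto.1 (Metric.cauchy_iff.2 ⟨inferInstance, fun ε hε => ?_⟩)
      obtain ⟨g, hg, hfg⟩ := h (ε / 8) (by positivity)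
      obtain ⟨y, hy⟩ := (hg t).2
      refine ⟨Metric.ball y (ε / 4), mem_map.2 ?_, fun a ha b hb => ?_⟩
      · filter_upwards [Metric.tendsto_nhds.1 hy (ε / 8) (by positivity)] with s hs
        have h1 := hfg s
        simp only [mem_preimage, Metric.mem_ball]
        rw [Real.dist_eq, abs_lt] at *
        rw [abs_le] at h1
        constructor <;> linarith
      · have := dist_triangle_right a b y
        rw [Metric.mem_ball] at ha hb
        linarith

/-! ### Completeness of the Skorokhod space -/

namespace CadlagPath

variable {T : ℝ}

theorem edist_le_of_timeChange {x y : CadlagPath T} {ε : ℝ} (l : TimeChange T)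
    (hl : l.logNorm ≤ ENNReal.ofReal ε) (h : ∀ t, |x t - y (l t)| ≤ ε) :
    edist x y ≤ ENNReal.ofReal ε :=
  iInf_le_of_le l (max_le hl (iSup_le fun t => ENNReal.ofReal_le_ofReal (h t)))

theorem exists_timeChange_of_edist_lt {x y : CadlagPath T} {ε : ℝ} (hε : 0 ≤ ε)
    (h : edist x y < ENNReal.ofReal ε) : ∃ l : TimeChange T,
      l.logNorm ≤ ENNReal.ofReal ε ∧ ∀ t, |x t - y (l t)| ≤ ε := by
  obtain ⟨l, hl⟩ := iInf_lt_iff.1 h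
  refine ⟨l, (le_max_left _ _).trans hl.le, fun t => ?_⟩
  have h2 : ENNReal.ofReal |x t - y (l t)| ≤ ENNReal.ofReal ε :=
    (le_iSup_of_le t le_rfl).trans ((le_max_right _ _).trans hl.le)
  exact (ENNReal.ofReal_le_ofReal_iff hε).1 h2

/-- A rapidly Cauchy sequence `u` comes with time changes `l n` linking `u n` to `u (n + 1)`. Their
compositions `m n` converge to a time change `M`, the paths `u n ∘ m n` converge uniformly, and the
limit of `u` is the limit of these paths composed with `M⁻¹`. -/
instance : CompleteSpace (CadlagPath T) := by
  refine EMetric.complete_of_convergent_controlled_sequences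
    (fun n => ENNReal.ofReal ((1 / 2 : ℝ) ^ n)) (fun n => ENNReal.ofReal_pos.2 (by positivity)) ?_
  intro u hu
  have hstep : ∀ n, ∃ l : TimeChange T, l.logNorm ≤ ENNReal.ofReal ((1 / 2 : ℝ) ^ n) ∧
      ∀ t, |u n t - u (n + 1) (l t)| ≤ (1 / 2 : ℝ) ^ n := fun n =>
    exists_timeChange_of_edist_lt (by positivity) (hu n n (n + 1) le_rfl n.le_succ)
  choose l hlog hl using hstep
  let m : ℕ → TimeChange T := fun n => Nat.rec (OrderIso.refl _) (fun k g => g.trans (l k)) n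
  have m_succ : ∀ n t, m (n + 1) t = l n (m n t) := fun n t => rfl
  have hpow : ∀ n : ℕ, (1 / 2 : ℝ) ^ n ≤ 1 := fun n => pow_le_one₀ (by norm_num) (by norm_num)
  have hlog' : ∀ n k, TimeChange.logNorm ((m n).symm.trans (m (n + k)) : TimeChange T) ≤
      ENNReal.ofReal (2 * (1 / 2 : ℝ) ^ n - 2 * (1 / 2 : ℝ) ^ (n + k)) := by
    intro n k
    induction k with
    | zero => simp [TimeChange.logNorm_refl]
    | succ k ih =>
      have e : ((m n).symm.trans (m (n + (k + 1))) : TimeChange T)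
          = ((m n).symm.trans (m (n + k)) : TimeChange T).trans (l (n + k)) := rfl
      rw [e]
      refine (TimeChange.logNorm_trans_le _ _).trans ((add_le_add ih (hlog _)).trans ?_)
      have h1 : (1 / 2 : ℝ) ^ (n + k) ≤ (1 / 2 : ℝ) ^ n :=
        pow_le_pow_of_le_one (by norm_num) (by norm_num) (by omega)
      rw [← ENNReal.ofReal_add (by linarith) (by positivity), ← add_assoc n k 1, pow_succ]
      exact ENNReal.ofReal_le_ofReal (by linarith)
  have hbounds : ∀ n k (s t : Icc (0 : ℝ) T), s < t →
      Real.exp (-(2 * (1 / 2 : ℝ) ^ n)) * ((t : ℝ) - s)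
          ≤ (m (n + k) ((m n).symm t) : ℝ) - m (n + k) ((m n).symm s) ∧
        (m (n + k) ((m n).symm t) : ℝ) - m (n + k) ((m n).symm s)
          ≤ Real.exp (2 * (1 / 2 : ℝ) ^ n) * ((t : ℝ) - s) := by
    intro n k
    refine (TimeChange.logNorm_le_ofReal_iff _ (by positivity)).1 ((hlog' n k).trans ?_)
    exact ENNReal.ofReal_le_ofReal (by linarith [show (0 : ℝ) ≤ (1 / 2 : ℝ) ^ (n + k) by positivity])
  have hlim : ∀ t, ∃ y : ℝ, Tendsto (fun n => (m n t : ℝ)) atTop (𝓝 y) := fun t =>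
    cauchySeq_tendsto_of_complete <| cauchySeq_of_le_geometric (1 / 2) (T * 2) (by norm_num)
      fun n => by
        rw [dist_comm, Real.dist_eq, m_succ]
        exact TimeChange.abs_apply_sub_le _ (by positivity) (hpow n) (hlog n) _
  choose L hL using hlim
  have hex : ∀ n, ∃ g : TimeChange T, (∀ t, (g t : ℝ) = L ((m n).symm t)) ∧
      g.logNorm ≤ ENNReal.ofReal (2 * (1 / 2 : ℝ) ^ n) := by
    intro n
    refine TimeChange.exists_of_quotient_bounds (by positivity) _ (fun t ht => ?_) (fun t ht => ?_)
      fun s t hst => ?_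
    · refine tendsto_nhds_unique (hL _) ?_
      rw [TimeChange.apply_eq_of_eq_zero _ ht]
      simp only [TimeChange.apply_eq_of_eq_zero _ ht, ht]
      exact tendsto_const_nhds
    · refine tendsto_nhds_unique (hL _) ?_
      rw [TimeChange.apply_eq_of_eq_right _ ht]
      simp only [TimeChange.apply_eq_of_eq_right _ ht, ht]
      exact tendsto_const_nhds
    · have hlim := ((hL ((m n).symm t)).sub (hL ((m n).symm s))).comp (tendsto_add_atTop_nat n)
      refine ⟨ge_of_tendsto' hlim fun k => ?_, le_of_tendsto' hlim fun k => ?_⟩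
      · simpa [add_comm] using (hbounds n k s t hst).1
      · simpa [add_comm] using (hbounds n k s t hst).2
  choose g hg hglog using hex
  have hg0 : ∀ n t, g n t = g 0 ((m n).symm t) := fun n t =>
    Subtype.ext (by rw [hg, hg]; rfl)
  have hdist : ∀ t n, dist (u n (m n t)) (u (n + 1) (m (n + 1) t)) ≤ 1 * (1 / 2 : ℝ) ^ n :=
    fun t n => by
      rw [Real.dist_eq, m_succ, one_mul]
      exact hl n _
  have hv : ∀ t, ∃ y : ℝ, Tendsto (fun n => u n (m n t)) atTop (𝓝 y) := fun t =>
    cauchySeq_tendsto_of_complete <| cauchySeq_of_le_geometric (1 / 2) 1 (by norm_num) (hdist t)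
  choose v hv using hv
  have hclose : ∀ n t, |u n t - v ((g 0).symm (g n t))| ≤ 2 * (1 / 2 : ℝ) ^ n := by
    intro n t
    have h := dist_le_of_le_geometric_of_tendsto (1 / 2) 1 (by norm_num)
      (hdist ((m n).symm t)) (hv ((m n).symm t)) n
    rw [OrderIso.apply_symm_apply, Real.dist_eq] at h
    rw [hg0, OrderIso.symm_apply_apply]
    refine h.trans (le_of_eq ?_)
    ring
  have hsmall : Tendsto (fun n : ℕ => 2 * (1 / 2 : ℝ) ^ n) atTop (𝓝 0) := by
    simpa using (tendsto_pow_atTop_nhds_zero_of_lt_one (r := (1 / 2 : ℝ)) (by norm_num)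
      (by norm_num)).const_mul 2
  let x : CadlagPath T :=
    { toFun := fun t => v ((g 0).symm t)
      isCadlag := isCadlag_of_forall_approx fun ε hε => by
        obtain ⟨n, hn⟩ := (hsmall.eventually_lt_const hε).exists
        refine ⟨_, (u n).isCadlag.comp_timeChange (g n).symm, fun t => ?_⟩
        have := hclose n ((g n).symm t)
        rw [OrderIso.apply_symm_apply] at this
        rw [abs_sub_comm]
        exact this.trans hn.le
      map_zero := fun t ht => by
        refine tendsto_nhds_unique (l := (atTop : Filter ℕ)) tendsto_const_nhds ?_
        refine squeeze_zero_norm (fun n => ?_) hsmall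
        have := hclose n t
        rwa [(u n).map_zero t ht, TimeChange.apply_eq_of_eq_zero _ ht, zero_sub, abs_neg] at this }
  refine ⟨x, tendsto_iff_edist_tendsto_0.2 ?_⟩
  have hz : Tendsto (fun n : ℕ => ENNReal.ofReal (2 * (1 / 2 : ℝ) ^ n)) atTop (𝓝 0) := by
    simpa using ENNReal.tendsto_ofReal hsmall
  exact tendsto_of_tendsto_of_tendsto_of_le_of_le tendsto_const_nhds hz (fun _ => bot_le)
    fun n => edist_le_of_timeChange (g n) (hglog n) (hclose n)

end CadlagPath

/-! ### Approximation by finitely many step paths -/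

theorem isCadlag_comp_floor {T h : ℝ} (hh : 0 < h) (c : ℕ → ℝ) :
    IsCadlag fun t : Icc (0 : ℝ) T => c ⌊(t : ℝ) / h⌋₊ := by
  intro t
  have hval : Tendsto (fun s : Icc (0 : ℝ) T => (s : ℝ)) (𝓝 t) (𝓝 (t : ℝ)) :=
    continuous_subtype_val.tendsto t
  constructor
  · refine tendsto_const_nhds.congr' ?_
    have hlt : (t : ℝ) < (⌊(t : ℝ) / h⌋₊ + 1) * h := by
      rw [← div_lt_iff₀ hh]; exact Nat.lt_floor_add_one _
    filter_upwards [nhdsWithin_le_nhds (hval.eventually_lt_const hlt), self_mem_nhdsWithin]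
      with s h1 h2
    have h2' : (t : ℝ) < s := h2
    congr 1
    symm
    rw [Nat.floor_eq_iff (div_nonneg s.2.1 hh.le)]
    refine ⟨(Nat.floor_le (div_nonneg t.2.1 hh.le)).trans ?_, by rwa [div_lt_iff₀ hh]⟩
    gcongr
  · refine ⟨c (⌈(t : ℝ) / h⌉₊ - 1), tendsto_const_nhds.congr' ?_⟩
    rcases t.2.1.eq_or_lt with h0 | h0
    · refine eventually_nhdsWithin_of_forall fun s hs => ?_
      have h1 : (s : ℝ) < t := hs
      have := s.2.1
      linarith
    · have hpos : 0 < ⌈(t : ℝ) / h⌉₊ := Nat.ceil_pos.2 (div_pos h0 hh)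
      have hcast : ((⌈(t : ℝ) / h⌉₊ - 1 : ℕ) : ℝ) = (⌈(t : ℝ) / h⌉₊ : ℝ) - 1 := by
        rw [Nat.cast_sub hpos, Nat.cast_one]
      have hlt : ((⌈(t : ℝ) / h⌉₊ : ℝ) - 1) * h < t := by
        rw [← lt_div_iff₀ hh]
        linarith [Nat.ceil_lt_add_one (div_nonneg t.2.1 hh.le)]
      filter_upwards [nhdsWithin_le_nhds (hval.eventually_const_lt hlt), self_mem_nhdsWithin]
        with s h1 h2
      have h2' : (s : ℝ) < t := h2
      congr 1
      symm
      rw [Nat.floor_eq_iff (div_nonneg s.2.1 hh.le), hcast]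
      refine ⟨by rw [le_div_iff₀ hh]; exact h1.le, ?_⟩
      have h3 : (s : ℝ) / h < t / h := by gcongr
      have h4 := Nat.le_ceil ((t : ℝ) / h)
      linarith

/-- The step path with value `c i` on `[i h, (i + 1) h)` for `i ≥ 1`, and `0` on `[0, h)`. -/
noncomputable def CadlagPath.step (T : ℝ) {h : ℝ} (hh : 0 < h) (c : ℕ → ℝ) : CadlagPath T where
  toFun t := if ⌊(t : ℝ) / h⌋₊ = 0 then 0 else c ⌊(t : ℝ) / h⌋₊
  isCadlag := isCadlag_comp_floor hh fun i => if i = 0 then 0 else c i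
  map_zero t ht := by simp [ht]

/-- `[0, T]` can be cut at points at distance at least `δ` from each other into intervals
`[b, b')` on which `x` oscillates by at most `c`. The set `B` holds the cut points and both end
points; that `s` and `t` lie in the same interval is expressed as `(s, t] ∩ B = ∅`. -/
def CadlagPath.HasSparsePartition {T : ℝ} (x : CadlagPath T) (δ c : ℝ) : Prop :=
  ∃ B : Set (Icc (0 : ℝ) T),
    (∀ t : Icc (0 : ℝ) T, (t : ℝ) = 0 → t ∈ B) ∧ (∀ t : Icc (0 : ℝ) T, (t : ℝ) = T → t ∈ B) ∧
    (∀ s ∈ B, ∀ t ∈ B, s < t → δ ≤ (t : ℝ) - s) ∧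
    ∀ s t, s ≤ t → Disjoint (Ioc s t) B → |x t - x s| ≤ c

/-- A time change that moves each point `b` of a sparse set to `⌊b / h⌋ h`: the displacements are
Lipschitz on the sparse set with a small constant, hence extend to `[0, T]`. -/
theorem TimeChange.exists_apply_eq_floor_mul {T h δ ρ : ℝ} {N : ℕ} (hh : 0 < h) (hN : T = N * h)
    (hρ : 0 < ρ) (hρ1 : ρ ≤ 1 / 2) (hhδ : h ≤ ρ * δ) {B : Set (Icc (0 : ℝ) T)}
    (h0 : ∀ t : Icc (0 : ℝ) T, (t : ℝ) = 0 → t ∈ B)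
    (h1 : ∀ t : Icc (0 : ℝ) T, (t : ℝ) = T → t ∈ B)
    (hB : ∀ s ∈ B, ∀ t ∈ B, s < t → δ ≤ (t : ℝ) - s) :
    ∃ l : TimeChange T, l.logNorm ≤ ENNReal.ofReal (2 * ρ) ∧
      ∀ b ∈ B, (l b : ℝ) = ⌊(b : ℝ) / h⌋₊ * h := by
  let g : Icc (0 : ℝ) T → ℝ := fun t => ⌊(t : ℝ) / h⌋₊ * h - t
  have hg : ∀ t, g t ≤ 0 ∧ -h ≤ g t := fun t => by
    have h2 := Nat.floor_le (div_nonneg t.2.1 hh.le)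
    have h3 := (Nat.lt_floor_add_one ((t : ℝ) / h)).le
    rw [le_div_iff₀ hh] at h2
    rw [div_le_iff₀ hh] at h3
    constructor <;> simp only [g] <;> linarith
  have hlip : LipschitzOnWith ρ.toNNReal g B := by
    have key : ∀ s ∈ B, ∀ t ∈ B, s < t → |g s - g t| ≤ ρ * |(s : ℝ) - t| := fun s hs t ht hst => by
      have h2 := hB s hs t ht hst
      have h3 : ρ * δ ≤ ρ * ((t : ℝ) - s) := by gcongr
      rw [abs_sub_comm (s : ℝ), abs_of_pos (sub_pos.2 (show (s : ℝ) < t from hst)), abs_le]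
      obtain ⟨a1, a2⟩ := hg s
      obtain ⟨a3, a4⟩ := hg t
      constructor <;> linarith
    refine LipschitzOnWith.of_dist_le_mul fun s hs t ht => ?_
    rw [Real.coe_toNNReal _ hρ.le, Real.dist_eq, Subtype.dist_eq, Real.dist_eq]
    rcases lt_trichotomy s t with hst | hst | hst
    · exact key s hs t ht hst
    · simp [hst]
    · rw [abs_sub_comm, abs_sub_comm (s : ℝ)]
      exact key t ht s hs hst
  obtain ⟨φ, hφ, hφg⟩ := hlip.extend_real
  have hφ' : ∀ s t : Icc (0 : ℝ) T, s < t → |φ t - φ s| ≤ ρ * ((t : ℝ) - s) := fun s t hst => by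
    have := hφ.dist_le_mul t s
    rwa [Real.coe_toNNReal _ hρ.le, Real.dist_eq, Subtype.dist_eq, Real.dist_eq,
      abs_of_pos (sub_pos.2 (show (s : ℝ) < t from hst))] at this
  have e1 : 1 + ρ ≤ Real.exp (2 * ρ) := by linarith [Real.add_one_le_exp (2 * ρ)]
  have e2 : Real.exp (-(2 * ρ)) ≤ 1 - ρ := by
    rw [Real.exp_neg]
    refine inv_le_of_inv_le₀ (by linarith) ((inv_le_of_inv_le₀ (by linarith) ?_).trans
      (show 1 + 2 * ρ ≤ _ by linarith [Real.add_one_le_exp (2 * ρ)]))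
    rw [inv_le_comm₀ (by linarith) (by linarith), ← one_div, div_le_iff₀ (by linarith)]
    nlinarith
  obtain ⟨l, hl, hlog⟩ := TimeChange.exists_of_quotient_bounds (κ := 2 * ρ) (by positivity)
    (fun t => (t : ℝ) + φ t)
    (fun t ht => by rw [← hφg (h0 t ht)]; simp [g, ht])
    (fun t ht => by
      rw [← hφg (h1 t ht)]
      have : T / h = N := by rw [hN]; field_simp
      simp [g, ht, this, ← hN])
    (fun s t hst => by
      have h2 := hφ' s t hst
      have h3 : (0 : ℝ) < (t : ℝ) - s := sub_pos.2 hst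
      rw [abs_le] at h2
      constructor
      · nlinarith [mul_le_mul_of_nonneg_right e2 h3.le]
      · nlinarith [mul_le_mul_of_nonneg_right e1 h3.le])
  refine ⟨l, hlog, fun b hb => ?_⟩
  rw [hl, ← hφg hb]
  simp [g]

/-- Bounded paths with a `δ`-sparse partition lie within `η` of a finite set: the cut points are
moved to a fixed fine grid, and the values are rounded to multiples of `η / 2`. -/
theorem CadlagPath.exists_finite_net {T : ℝ} (hT : 0 < T) {δ η : ℝ} (hδ : 0 < δ) (hη : 0 < η)
    (M : ℝ) : ∃ F : Set (CadlagPath T), F.Finite ∧ ∀ x : CadlagPath T,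
      x.HasSparsePartition δ (η / 2) → (∀ t, |x t| ≤ M) →
        ∃ y ∈ F, edist x y ≤ ENNReal.ofReal η := by
  set ρ : ℝ := min η 1 / 2 with hρ
  have hρ0 : 0 < ρ := by positivity
  have hρ1 : ρ ≤ 1 / 2 := by rw [hρ]; gcongr; exact min_le_right _ _
  have hρη : 2 * ρ ≤ η := by rw [hρ]; linarith [min_le_left η 1]
  set N : ℕ := ⌈T / (ρ * δ)⌉₊ with hNdef
  have hN0 : 0 < N := Nat.ceil_pos.2 (by positivity)
  have hN0' : (0 : ℝ) < N := by exact_mod_cast hN0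
  set h : ℝ := T / N with hhdef
  have hh : 0 < h := by positivity
  have hN : T = N * h := by rw [hhdef]; field_simp
  have hhδ : h ≤ ρ * δ := by
    rw [hhdef, div_le_iff₀ hN0', mul_comm, ← div_le_iff₀ (by positivity)]
    exact Nat.le_ceil _
  set m : ℤ := ⌈M / (η / 2)⌉ + 1 with hm
  refine ⟨range fun k : Fin (N + 1) → Icc (-m) m =>
    CadlagPath.step T hh fun i => η / 2 * ((k (Fin.ofNat (N + 1) i) : ℤ) : ℝ),
    finite_range _, ?_⟩
  rintro x ⟨B, h0, h1, hB, hosc⟩ hM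
  obtain ⟨l, hlog, hl⟩ := TimeChange.exists_apply_eq_floor_mul hh hN hρ0 hρ1 hhδ h0 h1 hB
  have hmem : ∀ i : ℕ, i ≤ N → (i : ℝ) * h ∈ Icc (0 : ℝ) T := fun i hi => by
    refine ⟨by positivity, ?_⟩
    rw [hN]
    gcongr
  have hfloor : ∀ v : ℝ, |v| ≤ M → ⌊v / (η / 2)⌋ ∈ Icc (-m) m := fun v hv => by
    obtain ⟨hv1, hv2⟩ := abs_le.1 hv
    have a1 : v / (η / 2) ≤ M / (η / 2) := by gcongr
    have a2 : -(M / (η / 2)) ≤ v / (η / 2) := by rw [← neg_div]; gcongr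
    have a3 := Int.le_ceil (M / (η / 2))
    constructor
    · rw [Int.le_floor, hm]
      push_cast
      linarith
    · have : (⌊v / (η / 2)⌋ : ℝ) ≤ m := by
        rw [hm]
        push_cast
        linarith [Int.floor_le (v / (η / 2))]
      exact_mod_cast this
  refine ⟨_, ⟨fun j => ⟨⌊x (l.symm ⟨((j : ℕ) : ℝ) * h, hmem j (by omega)⟩) / (η / 2)⌋,
    hfloor _ (hM _)⟩, rfl⟩, ?_⟩
  refine edist_le_of_timeChange l (hlog.trans (ENNReal.ofReal_le_ofReal hρη)) fun t => ?_
  set i : ℕ := ⌊(l t : ℝ) / h⌋₊ with hi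
  have hi1 : (i : ℝ) * h ≤ l t := by
    rw [← le_div_iff₀ hh]; exact Nat.floor_le (div_nonneg (l t).2.1 hh.le)
  have hi2 : (l t : ℝ) < (i + 1) * h := by rw [← div_lt_iff₀ hh]; exact Nat.lt_floor_add_one _
  have hiN : i ≤ N := by
    have h2 : (i : ℝ) * h ≤ N * h := hi1.trans (by rw [← hN]; exact (l t).2.2)
    exact_mod_cast le_of_mul_le_mul_right h2 hh
  set s : Icc (0 : ℝ) T := l.symm ⟨(i : ℝ) * h, hmem i hiN⟩ with hs
  have hst : s ≤ t := by
    rw [hs, OrderIso.symm_apply_le]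
    exact hi1
  -- a cut point `b ∈ (s, t]` would be moved to a grid point strictly between `i h` and `(i + 1) h`
  have hdisj : Disjoint (Ioc s t) B := by
    rw [Set.disjoint_left]
    rintro b ⟨hb1, hb2⟩ hb
    have h2 : (i : ℝ) * h < l b := by
      have := l.strictMono hb1
      rwa [hs, OrderIso.apply_symm_apply] at this
    have h3 : (l b : ℝ) < (i + 1) * h := lt_of_le_of_lt (l.monotone hb2) hi2
    rw [hl b hb] at h2 h3
    have h4 : i < ⌊(b : ℝ) / h⌋₊ := by exact_mod_cast lt_of_mul_lt_mul_right h2 hh.le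
    have h5 : ⌊(b : ℝ) / h⌋₊ < i + 1 := by exact_mod_cast lt_of_mul_lt_mul_right h3 hh.le
    omega
  have hxts := hosc s t hst hdisj
  have hround : ∀ v : ℝ, |v - η / 2 * (⌊v / (η / 2)⌋ : ℝ)| ≤ η / 2 := fun v => by
    have a1 := Int.floor_le (v / (η / 2))
    have a2 := (Int.lt_floor_add_one (v / (η / 2))).le
    rw [le_div_iff₀ (by positivity)] at a1
    rw [div_le_iff₀ (by positivity)] at a2
    rw [abs_le]
    constructor <;> linarith
  simp only [CadlagPath.step, ← hi]
  split_ifs with hi0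
  · have : x s = 0 := by
      refine x.map_zero s ?_
      rw [hs, TimeChange.apply_eq_of_eq_zero]
      · simp [hi0]
      · simp [hi0]
    rw [this] at hxts
    exact hxts.trans (by linarith)
  · have hval : ((Fin.ofNat (N + 1) i : Fin (N + 1)) : ℕ) = i := by
      simp [Fin.ofNat, Nat.mod_eq_of_lt (Nat.lt_succ_of_le hiN)]
    simp only [hval, ← hs]
    have := abs_sub_le (x t) (x s) (η / 2 * (⌊x s / (η / 2)⌋ : ℝ))
    have := hround (x s)
    linarith

/-! ### Dyadic chaining -/

/-- One step of the chaining: each point of the dyadic grid of level `k + 1` is moved to a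
neighbouring point of level `k` at which the value of `f` is close. Such a map is monotone. -/
theorem exists_monotone_dyadic_parent {f : ℝ → ℝ} {T ε : ℝ} {k : ℕ} (hε : 0 ≤ ε)
    (H : ∀ i : ℕ,
      |f ((i + 1 : ℕ) * (T / 2 ^ (k + 1))) - f (i * (T / 2 ^ (k + 1)))| ≤ ε ∨
      |f ((i + 2 : ℕ) * (T / 2 ^ (k + 1))) - f ((i + 1 : ℕ) * (T / 2 ^ (k + 1)))| ≤ ε) :
    ∃ π : ℕ → ℕ, Monotone π ∧ (∀ i, π i = i / 2 ∨ π i = (i + 1) / 2) ∧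
      ∀ i : ℕ, |f (i * (T / 2 ^ (k + 1))) - f (π i * (T / 2 ^ k))| ≤ ε := by
  have hdouble : ∀ i : ℕ, (i : ℝ) * (T / 2 ^ k) = (2 * i : ℕ) * (T / 2 ^ (k + 1)) := fun i => by
    push_cast
    rw [pow_succ]
    field_simp
  have hex : ∀ i : ℕ, ∃ j : ℕ, (j = i / 2 ∨ j = (i + 1) / 2) ∧
      |f (i * (T / 2 ^ (k + 1))) - f (j * (T / 2 ^ k))| ≤ ε := fun i => by
    rcases Nat.even_or_odd' i with ⟨m, rfl | rfl⟩
    · refine ⟨m, by omega, ?_⟩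
      rw [hdouble, sub_self, abs_zero]
      exact hε
    · rcases H (2 * m) with h | h
      · exact ⟨m, by omega, by rwa [hdouble]⟩
      · refine ⟨m + 1, by omega, ?_⟩
        rw [hdouble, abs_sub_comm]
        exact h
  choose π hπ hclose using hex
  refine ⟨π, fun i j hij => ?_, hπ, hclose⟩
  rcases hij.eq_or_lt with rfl | hlt
  · exact le_rfl
  · have h1 := hπ i
    have h2 := hπ j
    omega

/-- If on all finer dyadic grids the smaller one of any two consecutive increments is at most
`ε k`, then on a dyadic interval of level `K` no grid point `i` at which `f` is far from its value
at the left end point can precede a grid point `j` at which `f` is far from its value at the right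
end point. -/
theorem dyadic_close_left_or_close_right {f : ℝ → ℝ} {T : ℝ} {ε : ℕ → ℝ} {K : ℕ}
    (hε : ∀ k, 0 ≤ ε k)
    (H : ∀ k, K ≤ k → ∀ i : ℕ,
      |f ((i + 1 : ℕ) * (T / 2 ^ k)) - f (i * (T / 2 ^ k))| ≤ ε k ∨
      |f ((i + 2 : ℕ) * (T / 2 ^ k)) - f ((i + 1 : ℕ) * (T / 2 ^ k))| ≤ ε k) (J n : ℕ) :
    ∀ i j : ℕ, J * 2 ^ n ≤ i → i ≤ j → j ≤ (J + 1) * 2 ^ n →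
      |f (i * (T / 2 ^ (K + n))) - f (J * (T / 2 ^ K))| ≤ ∑ m ∈ Finset.range n, ε (K + m + 1) ∨
      |f (j * (T / 2 ^ (K + n))) - f ((J + 1 : ℕ) * (T / 2 ^ K))|
        ≤ ∑ m ∈ Finset.range n, ε (K + m + 1) := by
  induction n with
  | zero =>
    intro i j h1 h2 h3
    simp only [pow_zero, mul_one] at h1 h3
    rcases eq_or_lt_of_le h1 with h | h
    · left; simp [h]
    · right
      have : j = J + 1 := by omega
      simp [this]
  | succ n ih =>
    intro i j h1 h2 h3
    obtain ⟨π, hmono, hπ, hclose⟩ := exists_monotone_dyadic_parent (hε (K + n + 1))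
      (H (K + n + 1) (by omega))
    rw [pow_succ, ← mul_assoc] at h1 h3
    have hi := hπ i
    have hj := hπ j
    rw [Finset.sum_range_succ, ← add_assoc K n 1]
    refine (ih (π i) (π j) (by omega) (hmono h2) (by omega)).imp (fun h => ?_) fun h => ?_
    · have := abs_sub_le (f (i * (T / 2 ^ (K + n + 1)))) (f (π i * (T / 2 ^ (K + n))))
        (f (J * (T / 2 ^ K)))
      linarith [hclose i]
    · have := abs_sub_le (f (j * (T / 2 ^ (K + n + 1)))) (f (π j * (T / 2 ^ (K + n))))
        (f ((J + 1 : ℕ) * (T / 2 ^ K)))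
      linarith [hclose j]

theorem tendsto_ceil_div_mul {d : ℕ → ℝ} (hd : ∀ n, 0 < d n) (hlim : Tendsto d atTop (𝓝 0))
    {s : ℝ} (hs : 0 ≤ s) :
    Tendsto (fun n => (⌈s / d n⌉₊ : ℝ) * d n) atTop (𝓝[≥] s) := by
  have hge : ∀ n, s ≤ (⌈s / d n⌉₊ : ℝ) * d n := fun n => by
    rw [← div_le_iff₀ (hd n)]; exact Nat.le_ceil _
  refine tendsto_nhdsWithin_iff.2 ⟨?_, Eventually.of_forall hge⟩
  refine tendsto_of_tendsto_of_tendsto_of_le_of_le tendsto_const_nhds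
    (by simpa using (tendsto_const_nhds (x := s)).add hlim) hge fun n => ?_
  have h1 := (Nat.ceil_lt_add_one (div_nonneg hs (hd n).le)).le
  have h2 := mul_le_mul_of_nonneg_right h1 (hd n).le
  rwa [add_mul, one_mul, div_mul_cancel₀ _ (hd n).ne'] at h2

/-- The extension of the dyadic dichotomy to all times, by right-continuity. -/
theorem close_left_or_close_right {f : ℝ → ℝ} (hf : ∀ t, ContinuousWithinAt f (Ici t) t)
    {T : ℝ} (hT : 0 < T) {ε : ℕ → ℝ} {c : ℝ} {K : ℕ} (hε : ∀ k, 0 ≤ ε k)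
    (hc : ∀ n, ∑ m ∈ Finset.range n, ε (K + m + 1) ≤ c)
    (H : ∀ k, K ≤ k → ∀ i : ℕ,
      |f ((i + 1 : ℕ) * (T / 2 ^ k)) - f (i * (T / 2 ^ k))| ≤ ε k ∨
      |f ((i + 2 : ℕ) * (T / 2 ^ k)) - f ((i + 1 : ℕ) * (T / 2 ^ k))| ≤ ε k) (J : ℕ) {s u : ℝ}
    (hs : J * (T / 2 ^ K) ≤ s) (hsu : s ≤ u) (hu : u ≤ (J + 1 : ℕ) * (T / 2 ^ K)) :
    |f s - f (J * (T / 2 ^ K))| ≤ c ∨ |f u - f ((J + 1 : ℕ) * (T / 2 ^ K))| ≤ c := by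
  by_contra! hcon
  have hd : ∀ n, 0 < T / 2 ^ (K + n) := fun n => by positivity
  have hlim : Tendsto (fun n => T / 2 ^ (K + n)) atTop (𝓝 0) := by
    have h1 : Tendsto (fun n : ℕ => T / 2 ^ K * (1 / 2 : ℝ) ^ n) atTop (𝓝 0) := by
      simpa using (tendsto_pow_atTop_nhds_zero_of_lt_one (r := (1 / 2 : ℝ)) (by norm_num)
        (by norm_num)).const_mul (T / 2 ^ K)
    refine h1.congr fun n => ?_
    rw [pow_add, one_div, inv_pow, ← div_eq_mul_inv, div_div]
  have hs0 : 0 ≤ s := le_trans (by positivity) hs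
  have hscale : ∀ (i n : ℕ), (i : ℝ) * (T / 2 ^ K) = (i * 2 ^ n : ℕ) * (T / 2 ^ (K + n)) :=
    fun i n => by
      push_cast
      rw [pow_add]
      field_simp
  have e1 := ((hf s).tendsto.comp (tendsto_ceil_div_mul hd hlim hs0)).sub_const
    (f (J * (T / 2 ^ K)))
  have e2 := ((hf u).tendsto.comp (tendsto_ceil_div_mul hd hlim (hs0.trans hsu))).sub_const
    (f ((J + 1 : ℕ) * (T / 2 ^ K)))
  obtain ⟨n, hn1, hn2⟩ :=
    ((e1.abs.eventually_const_lt hcon.1).and (e2.abs.eventually_const_lt hcon.2)).exists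
  have h1 : ((J * 2 ^ n : ℕ) : ℝ) ≤ s / (T / 2 ^ (K + n)) := by
    rw [le_div_iff₀ (hd n), ← hscale]
    exact hs
  have h2 : ⌈u / (T / 2 ^ (K + n))⌉₊ ≤ (J + 1) * 2 ^ n := by
    rw [Nat.ceil_le, div_le_iff₀ (hd n), ← hscale]
    exact hu
  rcases dyadic_close_left_or_close_right hε H J n ⌈s / (T / 2 ^ (K + n))⌉₊
    ⌈u / (T / 2 ^ (K + n))⌉₊ (by exact_mod_cast h1.trans (Nat.le_ceil _)) (by gcongr) h2 with h | h
  · exact absurd (h.trans (hc n)) (not_le.2 hn1)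
  · exact absurd (h.trans (hc n)) (not_le.2 hn2)

/-- The dichotomy makes `f` stay close to `f a` up to some time `σ`, and close to `f b` from `σ`
on. -/
theorem exists_switching_time {f : ℝ → ℝ} (hf : ∀ t, ContinuousWithinAt f (Ici t) t)
    {a b c : ℝ} (hab : a ≤ b) (hc : 0 ≤ c)
    (h : ∀ s u, a ≤ s → s ≤ u → u ≤ b → |f s - f a| ≤ c ∨ |f u - f b| ≤ c) :
    ∃ σ ∈ Icc a b, ∀ t ∈ Icc a b, (t < σ → |f t - f a| ≤ c) ∧ (σ ≤ t → |f t - f b| ≤ c) := by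
  set A : Set ℝ := {s | s ∈ Icc a b ∧ (c < |f s - f a| ∨ s = b)} with hA
  have hbA : b ∈ A := ⟨⟨hab, le_rfl⟩, Or.inr rfl⟩
  have hbdd : BddBelow A := ⟨a, fun s hs => hs.1.1⟩
  have hσb : sInf A ≤ b := csInf_le hbdd hbA
  have hσa : a ≤ sInf A := le_csInf ⟨b, hbA⟩ fun s hs => hs.1.1
  have hright : ∀ t, sInf A < t → t ≤ b → |f t - f b| ≤ c := fun t ht htb => by
    obtain ⟨s, ⟨hs1, hs2⟩, hst⟩ := exists_lt_of_csInf_lt ⟨b, hbA⟩ ht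
    rcases hs2 with hs2 | rfl
    · exact (h s t hs1.1 hst.le htb).resolve_left (not_le.2 hs2)
    · exact absurd hst (not_lt.2 htb)
  refine ⟨sInf A, ⟨hσa, hσb⟩, fun t ht => ⟨fun hlt => ?_, fun hle => ?_⟩⟩
  · by_contra! hcon
    exact not_le.2 hlt (csInf_le hbdd ⟨ht, Or.inl hcon⟩)
  · rcases ht.2.eq_or_lt with rfl | htb
    · simpa using hc
    · have hlim : Tendsto (fun u => |f u - f b|) (𝓝[>] t) (𝓝 |f t - f b|) :=
        (((hf t).mono Ioi_subset_Ici_self).tendsto.sub_const _).abs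
      refine le_of_tendsto hlim ?_
      filter_upwards [Ioo_mem_nhdsGT htb] with u hu
      exact hright u (hle.trans_lt hu.1) hu.2.le

/-! ### From switching times to sparse partitions -/

/-- Suppose `f` has a switching time `σ J` in each interval `[J d, (J + 1) d]`, and no two
consecutive increments of `f` along the grid are both large, nor is the first or the last one. The
switching times with a large increment are then `d`-separated. Adding those points of the grid that
are not within `d / 2` of them gives a `d / 2`-sparse partition; its intervals meet at most three
cells of the grid. -/
theorem exists_sparse_partition_of_switching_times {f : ℝ → ℝ} {d ε c : ℝ} (hd : 0 < d)
    (hε : 0 ≤ ε) (hc : 0 ≤ c) {N : ℕ} {σ : ℕ → ℝ}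
    (hσ : ∀ J : ℕ, σ J ∈ Icc (J * d) ((J + 1 : ℕ) * d))
    (hclose : ∀ J : ℕ, ∀ t ∈ Icc (J * d) ((J + 1 : ℕ) * d),
      (t < σ J → |f t - f (J * d)| ≤ c) ∧ (σ J ≤ t → |f t - f ((J + 1 : ℕ) * d)| ≤ c))
    (hmin : ∀ i : ℕ, |f ((i + 1 : ℕ) * d) - f (i * d)| ≤ ε ∨
      |f ((i + 2 : ℕ) * d) - f ((i + 1 : ℕ) * d)| ≤ ε)
    (hfirst : |f ((0 + 1 : ℕ) * d) - f ((0 : ℕ) * d)| ≤ ε)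
    (hlast : ∀ i : ℕ, N ≤ i + 1 → |f ((i + 1 : ℕ) * d) - f (i * d)| ≤ ε) :
    ∃ B : Set ℝ, 0 ∈ B ∧ N * d ∈ B ∧ (∀ s ∈ B, ∀ t ∈ B, s < t → d / 2 ≤ t - s) ∧
      ∀ s t, 0 ≤ s → s ≤ t → t ≤ N * d → Disjoint (Ioc s t) B →
        |f t - f s| ≤ 3 * (2 * c + ε) := by
  set S : Set ℝ := {x | ∃ J : ℕ, ε < |f ((J + 1 : ℕ) * d) - f (J * d)| ∧ x = σ J} with hS
  have hgrid : ∀ i j : ℕ, i ≤ j → (i : ℝ) * d ≤ j * d := fun i j hij => by gcongr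
  have hSS : ∀ s ∈ S, ∀ t ∈ S, s < t → d ≤ t - s := by
    rintro _ ⟨I, hI, rfl⟩ _ ⟨J, hJ, rfl⟩ hst
    have h1 : I < J := by
      by_contra! hle
      rcases hle.eq_or_lt with rfl | hlt
      · exact lt_irrefl _ hst
      · linarith [(hσ J).2, (hσ I).1, hgrid (J + 1) I hlt]
    have h2 : J ≠ I + 1 := by
      rintro rfl
      rcases hmin I with h | h
      · exact not_le.2 hI h
      · exact not_le.2 hJ h
    have h3 := hgrid (I + 2) J (by omega)
    have h4 := (hσ I).2
    have h5 := (hσ J).1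
    push_cast at h3 h4
    linarith
  set G : Set ℝ := {x | ∃ i : ℕ, i ≤ N ∧ x = i * d ∧ ∀ y ∈ S, d / 2 ≤ |x - y|} with hG
  have hGG : ∀ s ∈ G, ∀ t ∈ G, s < t → d ≤ t - s := by
    rintro _ ⟨i, -, rfl, -⟩ _ ⟨j, -, rfl, -⟩ hst
    have h1 : i < j := by exact_mod_cast lt_of_mul_lt_mul_right hst hd.le
    have h2 := hgrid (i + 1) j h1
    push_cast at h2
    linarith
  refine ⟨S ∪ G, Or.inr ⟨0, by omega, by simp, ?_⟩, Or.inr ⟨N, le_rfl, rfl, ?_⟩, ?_, ?_⟩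
  · rintro _ ⟨J, hJ, rfl⟩
    have h1 : J ≠ 0 := by
      rintro rfl
      exact not_le.2 hJ hfirst
    have h2 := hgrid 1 J (by omega)
    have h3 := (hσ J).1
    rw [zero_sub, abs_neg]
    refine le_trans ?_ (le_abs_self _)
    push_cast at h2
    linarith
  · rintro _ ⟨J, hJ, rfl⟩
    have h1 : ¬ N ≤ J + 1 := fun h => not_le.2 hJ (hlast J h)
    have h2 := hgrid (J + 2) N (by omega)
    have h3 := (hσ J).2
    refine le_trans ?_ (le_abs_self _)
    push_cast at h2 h3
    linarith
  · rintro s (hs | hs) t (ht | ht) hst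
    · linarith [hSS s hs t ht hst]
    · obtain ⟨i, -, -, h⟩ := ht
      have := h s hs
      rwa [abs_of_pos (by linarith)] at this
    · obtain ⟨i, -, -, h⟩ := hs
      have := h t ht
      rwa [abs_sub_comm, abs_of_pos (by linarith)] at this
    · linarith [hGG s hs t ht hst]
  · -- within one cell of the grid, a small increment keeps the oscillation below `2 c + ε`
    have hcell : ∀ (J : ℕ) (s t : ℝ), s ∈ Icc (J * d) ((J + 1 : ℕ) * d) →
        t ∈ Icc (J * d) ((J + 1 : ℕ) * d) → s ≤ t → Disjoint (Ioc s t) S →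
        |f t - f s| ≤ 2 * c + ε := by
      intro J s t hs ht hst hdisj
      obtain ⟨s1, s2⟩ := hclose J s hs
      obtain ⟨t1, t2⟩ := hclose J t ht
      rcases lt_or_ge t (σ J) with h | h
      · have a1 := s1 (hst.trans_lt h)
        have a2 := t1 h
        rw [abs_le] at *
        constructor <;> linarith [a1.1, a1.2, a2.1, a2.2]
      rcases lt_or_ge s (σ J) with h' | h'
      · have a1 := s1 h'
        have a2 := t2 h
        have a3 : |f ((J + 1 : ℕ) * d) - f (J * d)| ≤ ε := by
          by_contra! hbig
          exact Set.disjoint_left.1 hdisj ⟨h', h⟩ ⟨J, hbig, rfl⟩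
        rw [abs_le] at *
        constructor <;> linarith [a1.1, a1.2, a2.1, a2.2, a3.1, a3.2]
      · have a1 := s2 h'
        have a2 := t2 h
        rw [abs_le] at *
        constructor <;> linarith [a1.1, a1.2, a2.1, a2.2]
    have hcells : ∀ (n J : ℕ) (s t : ℝ), s ∈ Icc (J * d) ((J + 1 : ℕ) * d) → s ≤ t →
        t ≤ (J + 1 + n : ℕ) * d → Disjoint (Ioc s t) S → |f t - f s| ≤ (n + 1) * (2 * c + ε) := by
      intro n
      induction n with
      | zero =>
        intro J s t hs hst ht hdisj
        simpa using hcell J s t hs ⟨hs.1.trans hst, ht⟩ hst hdisj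
      | succ n ih =>
        intro J s t hs hst ht hdisj
        rcases le_or_gt t ((J + 1 : ℕ) * d) with h | h
        · refine (hcell J s t hs ⟨hs.1.trans hst, h⟩ hst hdisj).trans ?_
          push_cast
          nlinarith [show (0 : ℝ) ≤ (n + 1) * (2 * c + ε) by positivity]
        · have h1 := hcell J s ((J + 1 : ℕ) * d) hs ⟨hgrid _ _ (by omega), le_rfl⟩ hs.2
            (hdisj.mono_left (Ioc_subset_Ioc_right h.le))
          have h2 := ih (J + 1) ((J + 1 : ℕ) * d) t ⟨le_rfl, hgrid _ _ (by omega)⟩ h.le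
            (by rwa [show J + 1 + 1 + n = J + 1 + (n + 1) by omega])
            (hdisj.mono_left (Ioc_subset_Ioc_left hs.2))
          have h3 := abs_sub_le (f t) (f ((J + 1 : ℕ) * d)) (f s)
          push_cast at h1 h2 h3 ⊢
          linarith
    intro s t hs hst ht hdisj
    set J := ⌊s / d⌋₊ with hJ
    have hJ1 : (J : ℝ) * d ≤ s := by
      rw [← le_div_iff₀ hd]; exact Nat.floor_le (div_nonneg hs hd.le)
    have hJ2 : s < (J + 1 : ℕ) * d := by
      rw [← div_lt_iff₀ hd]; push_cast; exact Nat.lt_floor_add_one _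
    have hJ3 : t ≤ (J + 1 + 2 : ℕ) * d := by
      by_contra! hlt
      have h1 : J + 1 + 2 < N := by exact_mod_cast lt_of_mul_lt_mul_right (hlt.trans_le ht) hd.le
      have h2 : ¬ ∀ y ∈ S, d / 2 ≤ |((J + 2 : ℕ) : ℝ) * d - y| := fun h => by
        refine Set.disjoint_left.1 hdisj ⟨?_, ?_⟩ (Or.inr ⟨J + 2, by omega, rfl, h⟩)
        · exact hJ2.trans_le (hgrid _ _ (by omega))
        · exact le_trans (hgrid _ _ (by omega)) hlt.le
      push Not at h2
      obtain ⟨y, hy, hyd⟩ := h2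
      rw [abs_lt] at hyd
      push_cast at hyd hJ2 hlt
      exact Set.disjoint_left.1 hdisj ⟨by linarith [hyd.2], by linarith [hyd.1]⟩ (Or.inl hy)
    have := hcells 2 J s t ⟨hJ1, hJ2.le⟩ hst hJ3 (hdisj.mono_right subset_union_left)
    norm_num at this ⊢
    exact this

/-! ### Measurability of the evaluation maps -/

namespace CadlagPath

variable {T : ℝ}

theorem isClosed_forall_mem_le {U : Set (Icc (0 : ℝ) T)}
    (hU : ∀ s ∈ U, ∃ ε > 0, ∀ l : TimeChange T, l.logNorm ≤ ENNReal.ofReal ε → l s ∈ U) (c : ℝ) :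
    IsClosed {x : CadlagPath T | ∀ s ∈ U, x s ≤ c} := by
  rw [← isOpen_compl_iff, EMetric.isOpen_iff]
  intro x hx
  simp only [mem_compl_iff, mem_ofPred_eq, not_forall, not_le] at hx
  obtain ⟨s, hs, hcs⟩ := hx
  obtain ⟨ε, hε, hl⟩ := hU s hs
  set δ := min ε ((x s - c) / 2) with hδ
  have hδ0 : 0 < δ := lt_min hε (by linarith)
  refine ⟨ENNReal.ofReal δ, ENNReal.ofReal_pos.2 hδ0, fun y hy => ?_⟩
  rw [Metric.mem_eball, edist_comm] at hy
  obtain ⟨l, hlog, hxy⟩ := exists_timeChange_of_edist_lt hδ0.le hy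
  simp only [mem_compl_iff, mem_ofPred_eq, not_forall, not_le]
  refine ⟨l s, hl l (hlog.trans (ENNReal.ofReal_le_ofReal (min_le_left _ _))), ?_⟩
  have h1 := (abs_le.1 (hxy s)).2
  have h2 : δ ≤ (x s - c) / 2 := min_le_right _ _
  linarith

/-- Evaluation at `t < T` is not continuous, but by right-continuity it is the decreasing limit of
the lower semicontinuous suprema over `(t, t + 1 / (n + 1))`. Evaluation at `T` is continuous. -/
theorem measurable_eval (t : Icc (0 : ℝ) T) : Measurable fun x : CadlagPath T => x t := by
  rcases t.2.2.eq_or_lt with htT | htT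
  · refine measurable_of_Iic fun c => IsClosed.measurableSet ?_
    have := isClosed_forall_mem_le (T := T) (U := {t}) (fun s hs => ⟨1, one_pos, fun l _ => by
      rw [mem_singleton_iff] at hs ⊢
      rw [hs, TimeChange.apply_eq_of_eq_right _ htT]⟩) c
    simpa [Set.preimage] using this
  · have hT : 0 < T := t.2.1.trans_lt htT
    have hte : t < ⟨T, t.2.1.trans t.2.2, le_rfl⟩ := htT
    have hne : (𝓝[>] t).NeBot := nhdsGT_neBot_of_exists_gt ⟨_, hte⟩
    refine measurable_of_Iio fun c => ?_
    let U : ℕ → Set (Icc (0 : ℝ) T) := fun n => {s | (t : ℝ) < s ∧ (s : ℝ) < t + 1 / ((n : ℝ) + 1)}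
    have hU : ∀ n, ∀ s ∈ U n, ∃ ε > 0, ∀ l : TimeChange T,
        l.logNorm ≤ ENNReal.ofReal ε → l s ∈ U n := by
      rintro n s ⟨h1, h2⟩
      set g := min ((s : ℝ) - t) (t + 1 / ((n : ℝ) + 1) - s) with hg
      have hg0 : 0 < g := lt_min (by linarith) (by linarith)
      have hε0 : 0 < min 1 (g / (4 * T)) := lt_min one_pos (by positivity)
      refine ⟨_, hε0, fun l hl => ?_⟩
      have h3 := l.abs_apply_sub_le hε0.le (min_le_left _ _) hl s
      have h4 : T * 2 * min 1 (g / (4 * T)) ≤ g / 2 := by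
        have h5 : T * 2 * min 1 (g / (4 * T)) ≤ T * 2 * (g / (4 * T)) := by
          gcongr; exact min_le_right _ _
        refine h5.trans (le_of_eq ?_)
        field_simp
        norm_num
      have h6 : g ≤ (s : ℝ) - t := min_le_left _ _
      have h7 : g ≤ t + 1 / ((n : ℝ) + 1) - s := min_le_right _ _
      rw [abs_le] at h3
      constructor <;> linarith [h3.1, h3.2]
    have hUt : ∀ n, U n ∈ 𝓝[>] t := fun n => by
      have h1 : ∀ᶠ s : Icc (0 : ℝ) T in 𝓝 t, (s : ℝ) < t + 1 / ((n : ℝ) + 1) :=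
        (continuous_subtype_val.tendsto t).eventually_lt_const
          (by linarith [Nat.one_div_pos_of_nat (α := ℝ) (n := n)])
      filter_upwards [nhdsWithin_le_nhds h1, self_mem_nhdsWithin] with s h2 h3
      exact ⟨h3, h2⟩
    have hset : (fun x : CadlagPath T => x t) ⁻¹' Iio c
        = ⋃ (n : ℕ) (k : ℕ), {x | ∀ s ∈ U n, x s ≤ c - 1 / ((k : ℝ) + 1)} := by
      ext x
      simp only [mem_preimage, mem_Iio, mem_iUnion, mem_ofPred_eq]
      constructor
      · intro hx
        obtain ⟨k, hk⟩ := exists_nat_one_div_lt (sub_pos.2 hx)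
        have h1 : ∀ᶠ s in 𝓝[>] t, x s < c - 1 / ((k : ℝ) + 1) :=
          (x.isCadlag t).1.eventually_lt_const (by linarith)
        obtain ⟨b, hb, hsub⟩ := (mem_nhdsGT_iff_exists_Ioo_subset' hte).1 h1
        obtain ⟨n, hn⟩ := exists_nat_one_div_lt (sub_pos.2 (show (t : ℝ) < b from hb))
        refine ⟨n, k, fun s hs => (hsub ⟨hs.1, ?_⟩).le⟩
        show (s : ℝ) < b
        linarith [hs.2]
      · rintro ⟨n, k, h⟩
        have h1 : x t ≤ c - 1 / ((k : ℝ) + 1) := by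
          refine le_of_tendsto (x.isCadlag t).1 ?_
          filter_upwards [hUt n] with s hs using h s hs
        linarith [Nat.one_div_pos_of_nat (α := ℝ) (n := k)]
    rw [hset]
    exact MeasurableSet.iUnion fun n => MeasurableSet.iUnion fun k =>
      (isClosed_forall_mem_le (hU n) _).measurableSet

/-! ### Sparse partitions from increments along dyadic grids -/

theorem continuousWithinAt_IccExtend (hT : 0 ≤ T) (x : CadlagPath T) (t : ℝ) :
    ContinuousWithinAt (IccExtend hT x) (Ici t) t := by
  have h1 : ContinuousWithinAt x (Ici (projIcc 0 T hT t)) (projIcc 0 T hT t) :=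
    continuousWithinAt_Ioi_iff_Ici.1 (x.isCadlag _).1
  exact h1.comp continuous_projIcc.continuousWithinAt fun s hs => monotone_projIcc hT hs

end CadlagPath

/-- The `i`-th point of the dyadic grid of level `k` in `[0, T]`; it is `T` for `i ≥ 2 ^ k`. -/
noncomputable def dyadicPoint {T : ℝ} (hT : 0 ≤ T) (k i : ℕ) : Icc (0 : ℝ) T :=
  projIcc 0 T hT (i * (T / 2 ^ k))

section dyadicPoint

variable {T : ℝ} (hT : 0 ≤ T)

theorem dyadicPoint_mono (k : ℕ) : Monotone (dyadicPoint hT k) := fun i j hij =>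
  monotone_projIcc hT (by gcongr)

theorem dyadicPoint_zero (k : ℕ) : (dyadicPoint hT k 0 : ℝ) = 0 := by
  simp [dyadicPoint, projIcc, hT]

theorem dyadicPoint_of_le {k i : ℕ} (h : 2 ^ k ≤ i) : (dyadicPoint hT k i : ℝ) = T := by
  have h1 : T ≤ i * (T / 2 ^ k) := by
    have h2 : ((2 ^ k : ℕ) : ℝ) ≤ i := by exact_mod_cast h
    calc T = ((2 ^ k : ℕ) : ℝ) * (T / 2 ^ k) := by push_cast; field_simp
      _ ≤ _ := by gcongr
  rw [dyadicPoint, projIcc_of_right_le hT h1]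

theorem dyadicPoint_eq_of_le {k i j : ℕ} (hi : 2 ^ k ≤ i) (hj : 2 ^ k ≤ j) :
    dyadicPoint hT k i = dyadicPoint hT k j :=
  Subtype.ext (by rw [dyadicPoint_of_le hT hi, dyadicPoint_of_le hT hj])

theorem abs_dyadicPoint_sub_le (k i m : ℕ) :
    |(dyadicPoint hT k (i + m) : ℝ) - dyadicPoint hT k i| ≤ m * (T / 2 ^ k) := by
  have h := abs_projIcc_sub_projIcc (h := hT) (c := ((i + m : ℕ) : ℝ) * (T / 2 ^ k))
    (d := (i : ℝ) * (T / 2 ^ k))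
  refine h.trans (le_of_eq ?_)
  rw [← sub_mul, abs_of_nonneg (by push_cast; rw [add_sub_cancel_left]; positivity)]
  push_cast
  ring

end dyadicPoint

/-- Conditions on the increments of `x` along dyadic grids that give `x` a partition with cut points
at distance at least `T / 2 ^ (K + 1)`, and bound `x` by its values on the grid of level `K`. -/
theorem CadlagPath.hasSparsePartition_of_dyadic {T : ℝ} (hT : 0 < T) (x : CadlagPath T)
    {ε : ℕ → ℝ} {e c : ℝ} {K : ℕ} (hε : ∀ k, 0 ≤ ε k) (hεe : ε K ≤ e)
    (hc : ∀ n, ∑ m ∈ Finset.range n, ε (K + m + 1) ≤ c)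
    (H : ∀ k, K ≤ k → ∀ i,
      |x (dyadicPoint hT.le k (i + 1)) - x (dyadicPoint hT.le k i)| ≤ ε k ∨
      |x (dyadicPoint hT.le k (i + 2)) - x (dyadicPoint hT.le k (i + 1))| ≤ ε k)
    (hfirst : |x (dyadicPoint hT.le K 1) - x (dyadicPoint hT.le K 0)| ≤ e)
    (hlast : |x (dyadicPoint hT.le K (2 ^ K - 1 + 1)) - x (dyadicPoint hT.le K (2 ^ K - 1))| ≤ e) :
    x.HasSparsePartition (T / 2 ^ K / 2) (3 * (2 * c + e)) ∧
      ∀ M, (∀ i ≤ 2 ^ K, |x (dyadicPoint hT.le K i)| ≤ M) → ∀ t, |x t| ≤ M + c := by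
  have hd : 0 < T / 2 ^ K := by positivity
  have hc0 : 0 ≤ c := by simpa using hc 0
  have hNd : ((2 ^ K : ℕ) : ℝ) * (T / 2 ^ K) = T := by push_cast; field_simp
  have hf := x.continuousWithinAt_IccExtend hT.le
  set f : ℝ → ℝ := IccExtend hT.le x with hfdef
  have hfx : ∀ t : Icc (0 : ℝ) T, f t = x t := fun t => IccExtend_val _ _ _
  have hsplit : ∀ J : ℕ, ∃ σ ∈ Icc (J * (T / 2 ^ K)) ((J + 1 : ℕ) * (T / 2 ^ K)),
      ∀ t ∈ Icc (J * (T / 2 ^ K)) ((J + 1 : ℕ) * (T / 2 ^ K)),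
        (t < σ → |f t - f (J * (T / 2 ^ K))| ≤ c) ∧
        (σ ≤ t → |f t - f ((J + 1 : ℕ) * (T / 2 ^ K))| ≤ c) := fun J =>
    exists_switching_time hf (by gcongr; omega) hc0 fun s u h1 h2 h3 =>
      close_left_or_close_right hf hT hε hc H J h1 h2 h3
  choose σ hσ hclose using hsplit
  refine ⟨?_, fun M hM t => ?_⟩
  · obtain ⟨B, hB0, hBT, hBsep, hBosc⟩ := exists_sparse_partition_of_switching_times (N := 2 ^ K)
      hd ((hε K).trans hεe) hc0 hσ hclose (fun i => (H K le_rfl i).imp (·.trans hεe) (·.trans hεe))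
      hfirst (fun i hi => by
        rcases hi.eq_or_lt with h | h
        · obtain rfl : i = 2 ^ K - 1 := by omega
          exact hlast
        · show |x (dyadicPoint hT.le K (i + 1)) - x (dyadicPoint hT.le K i)| ≤ e
          rw [dyadicPoint_eq_of_le hT.le (show 2 ^ K ≤ i + 1 by omega) (show 2 ^ K ≤ i by omega),
            sub_self, abs_zero]
          exact (hε K).trans hεe)
    rw [hNd] at hBT hBosc
    refine ⟨Subtype.val ⁻¹' B, fun t ht => ?_, fun t ht => ?_, fun s hs t ht hst =>
      hBsep s hs t ht hst, fun s t hst hdisj => ?_⟩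
    · rwa [mem_preimage, ht]
    · rwa [mem_preimage, ht]
    · rw [← hfx, ← hfx]
      refine hBosc s t s.2.1 hst t.2.2 (Set.disjoint_left.2 fun b hb hbB => ?_)
      have hmem : (⟨b, s.2.1.trans hb.1.le, hb.2.trans t.2.2⟩ : Icc (0 : ℝ) T) ∈ Ioc s t :=
        ⟨hb.1, hb.2⟩
      exact Set.disjoint_left.1 hdisj hmem hbB
  · -- `t` lies in the cell `[J d, (J + 1) d]`
    have key : ∀ J : ℕ, J + 1 ≤ 2 ^ K → (t : ℝ) ∈ Icc (J * (T / 2 ^ K)) ((J + 1 : ℕ) * (T / 2 ^ K)) →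
        |x t| ≤ M + c := fun J hJ ht => by
      obtain ⟨h1, h2⟩ := hclose J t ht
      rw [hfx] at h1 h2
      rcases lt_or_ge (t : ℝ) (σ J) with h | h
      · have h3 := h1 h
        have h4 : |f (J * (T / 2 ^ K))| ≤ M := hM J (by omega)
        have h5 := abs_sub_abs_le_abs_sub (x t) (f (J * (T / 2 ^ K)))
        linarith
      · have h3 := h2 h
        have h4 : |f ((J + 1 : ℕ) * (T / 2 ^ K))| ≤ M := hM (J + 1) hJ
        have h5 := abs_sub_abs_le_abs_sub (x t) (f ((J + 1 : ℕ) * (T / 2 ^ K)))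
        linarith
    rcases t.2.2.eq_or_lt with htT | htT
    · have hpos : 0 < 2 ^ K := by positivity
      refine key (2 ^ K - 1) (by omega) ⟨?_, ?_⟩
      · refine le_trans ?_ (hNd.trans htT.symm).le
        gcongr
        omega
      · rw [Nat.sub_add_cancel hpos, hNd, htT]
    · have hJ1 : ((⌊(t : ℝ) / (T / 2 ^ K)⌋₊ : ℕ) : ℝ) * (T / 2 ^ K) ≤ t := by
        rw [← le_div_iff₀ hd]; exact Nat.floor_le (div_nonneg t.2.1 hd.le)
      refine key ⌊(t : ℝ) / (T / 2 ^ K)⌋₊ ?_ ⟨hJ1, ?_⟩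
      · have h1 : ((⌊(t : ℝ) / (T / 2 ^ K)⌋₊ : ℕ) : ℝ) * (T / 2 ^ K)
            < ((2 ^ K : ℕ) : ℝ) * (T / 2 ^ K) := by rw [hNd]; exact hJ1.trans_lt htT
        exact_mod_cast lt_of_mul_lt_mul_right h1 hd.le
      · rw [← div_le_iff₀ hd]; push_cast; exact (Nat.lt_floor_add_one _).le

/-! ### A tightness criterion -/

/-- In a complete space, a set of measures is tight if for each `η` the closed `η`-balls around
finitely many points carry all but an arbitrarily small mass, uniformly. -/
theorem isTightMeasureSet_of_forall_exists_finite {E : Type*} [EMetricSpace E] [CompleteSpace E]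
    [MeasurableSpace E] {S : Set (Measure E)}
    (h : ∀ η > (0 : ℝ), ∀ α > (0 : ℝ), ∃ F : Set E, F.Finite ∧
      ∀ μ ∈ S, μ {x | ∀ y ∈ F, ¬ edist x y ≤ ENNReal.ofReal η} ≤ ENNReal.ofReal α) :
    IsTightMeasureSet S := by
  rw [isTightMeasureSet_iff_exists_isCompact_measure_compl_le]
  intro ε hε
  obtain ⟨α, hα, hsum⟩ := ENNReal.exists_pos_sum_of_countable hε.ne' ℕ
  choose F hF hμ using fun n : ℕ => h ((1 / 2) ^ n) (by positivity) (α n) (hα n)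
  refine ⟨⋂ n, ⋃ y ∈ F n, {x | edist x y ≤ ENNReal.ofReal ((1 / 2) ^ n)}, ?_, fun μ hmem => ?_⟩
  · refine TotallyBounded.isCompact_of_isClosed (EMetric.totallyBounded_iff.2 fun r hr => ?_)
      (isClosed_iInter fun n => (hF n).isClosed_biUnion fun y _ =>
        isClosed_le (continuous_id.edist continuous_const) continuous_const)
    have hlim : Tendsto (fun n : ℕ => ENNReal.ofReal ((1 / 2 : ℝ) ^ n)) atTop (𝓝 0) := by
      simpa using ENNReal.tendsto_ofReal (tendsto_pow_atTop_nhds_zero_of_lt_one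
        (r := (1 / 2 : ℝ)) (by norm_num) (by norm_num))
    obtain ⟨n, hn⟩ := (hlim.eventually_lt_const hr).exists
    refine ⟨F n, hF n, (iInter_subset _ n).trans (iUnion₂_mono fun y _ x hx => ?_)⟩
    rw [Metric.mem_eball]
    exact lt_of_le_of_lt hx hn
  · calc μ (⋂ n, ⋃ y ∈ F n, {x | edist x y ≤ ENNReal.ofReal ((1 / 2) ^ n)})ᶜ
        = μ (⋃ n, {x | ∀ y ∈ F n, ¬ edist x y ≤ ENNReal.ofReal ((1 / 2) ^ n)}) := by
          congr 1
          ext x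
          simp
      _ ≤ ∑' n, μ {x | ∀ y ∈ F n, ¬ edist x y ≤ ENNReal.ofReal ((1 / 2) ^ n)} :=
          measure_iUnion_le _
      _ ≤ ∑' n, (α n : ℝ≥0∞) := ENNReal.tsum_le_tsum fun n => by
          simpa using hμ n μ hmem
      _ ≤ ε := hsum.le

/-! ### Probability bounds -/

theorem lintegral_le_of_upperExpectation_le {Ω : Type*} [MeasurableSpace Ω]
    {Q : Set (ProbabilityMeasure Ω)} {X : Ω → ℝ≥0∞} {b : ℝ≥0∞} (h : upperExpectation Q X ≤ b)
    {P : ProbabilityMeasure Ω} (hP : P ∈ Q) : ∫⁻ ω, X ω ∂(P : Measure Ω) ≤ b :=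
  (le_iSup₂ (f := fun (P : ProbabilityMeasure Ω) (_ : P ∈ Q) => ∫⁻ ω, X ω ∂(P : Measure Ω))
    P hP).trans h

theorem measure_le_ofReal_div {Ω : Type*} [MeasurableSpace Ω] {μ : Measure Ω} {X : Ω → ℝ}
    (hX : Measurable X) {S : Set Ω} {v b : ℝ} (hv : 0 < v) (hS : ∀ ω ∈ S, v ≤ X ω)
    (h : ∫⁻ ω, ENNReal.ofReal (X ω) ∂μ ≤ ENNReal.ofReal b) : μ S ≤ ENNReal.ofReal (b / v) := by
  rw [ENNReal.ofReal_div_of_pos hv]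
  calc μ S ≤ μ {ω | ENNReal.ofReal v ≤ ENNReal.ofReal (X ω)} :=
        measure_mono fun ω hω => ENNReal.ofReal_le_ofReal (hS ω hω)
    _ ≤ (∫⁻ ω, ENNReal.ofReal (X ω) ∂μ) / ENNReal.ofReal v :=
        meas_ge_le_lintegral_div hX.ennreal_ofReal.aemeasurable (ENNReal.ofReal_pos.2 hv).ne'
          ENNReal.ofReal_ne_top
    _ ≤ _ := ENNReal.div_le_div_right h _

section Increments

variable {T : ℝ} {μ : Measure (CadlagPath T)} {ε : ℝ}

theorem measure_increment_gt_le {s t : Icc (0 : ℝ) T} {b : ℝ} (hε : 0 < ε)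
    (h : ∫⁻ ω, ENNReal.ofReal |ω t - ω s| ∂μ ≤ ENNReal.ofReal b) :
    μ {ω | ε < |ω t - ω s|} ≤ ENNReal.ofReal (b / ε) :=
  measure_le_ofReal_div (X := fun ω : CadlagPath T => |ω t - ω s|)
    ((CadlagPath.measurable_eval t).sub (CadlagPath.measurable_eval s)).abs hε
    (fun _ hω => le_of_lt hω) h

theorem measure_two_increments_gt_le {s u t : Icc (0 : ℝ) T} {b p q : ℝ} (hp : 0 ≤ p) (hq : 0 ≤ q)
    (hε : 0 < ε)
    (h : ∫⁻ ω, ENNReal.ofReal (|ω t - ω u| ^ p * |ω u - ω s| ^ q) ∂μ ≤ ENNReal.ofReal b) :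
    μ {ω | ε < |ω u - ω s| ∧ ε < |ω t - ω u|} ≤ ENNReal.ofReal (b / ε ^ (p + q)) := by
  refine measure_le_ofReal_div (X := fun ω : CadlagPath T => |ω t - ω u| ^ p * |ω u - ω s| ^ q)
    ?_ (by positivity) (fun ω hω => ?_) h
  · exact (((CadlagPath.measurable_eval t).sub (CadlagPath.measurable_eval u)).abs.pow_const p).mul
      (((CadlagPath.measurable_eval u).sub (CadlagPath.measurable_eval s)).abs.pow_const q)
  · obtain ⟨h1, h2⟩ := hω
    rw [Real.rpow_add hε]
    gcongr

/-- The union bound over all dyadic levels `k ≥ K` and all pairs of neighbouring increments. The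
threshold `θ ^ k` is chosen to decay so slowly that the bounds still form a convergent geometric
series. -/
theorem measure_exists_dyadic_increments_gt_le (hT : 0 ≤ T) {C r p q θ : ℝ} (hC : 0 ≤ C)
    (hr : 0 < r) (hp : 0 ≤ p) (hq : 0 ≤ q) (hθ : 0 < θ) (hθr : 1 < 2 ^ r * θ ^ (p + q))
    (h : ∀ s u t : Icc (0 : ℝ) T, s ≤ u → u ≤ t →
      ∫⁻ ω, ENNReal.ofReal (|ω t - ω u| ^ p * |ω u - ω s| ^ q) ∂μ
        ≤ ENNReal.ofReal (C * |(t : ℝ) - (s : ℝ)| ^ (1 + r))) (K : ℕ) :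
    μ {ω | ∃ k, K ≤ k ∧ ∃ i,
        θ ^ k < |ω (dyadicPoint hT k (i + 1)) - ω (dyadicPoint hT k i)| ∧
        θ ^ k < |ω (dyadicPoint hT k (i + 2)) - ω (dyadicPoint hT k (i + 1))|}
      ≤ ENNReal.ofReal (C * (2 * T) ^ (1 + r) / (1 - (2 ^ r * θ ^ (p + q))⁻¹)
          * (2 ^ r * θ ^ (p + q))⁻¹ ^ K) := by
  set ρ : ℝ := (2 ^ r * θ ^ (p + q))⁻¹ with hρ
  have hρ0 : 0 < ρ := by positivity
  have hρ1 : ρ < 1 := inv_lt_one_of_one_lt₀ hθr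
  set E : ℕ → ℕ → Set (CadlagPath T) := fun k i =>
    {ω | θ ^ k < |ω (dyadicPoint hT k (i + 1)) - ω (dyadicPoint hT k i)| ∧
      θ ^ k < |ω (dyadicPoint hT k (i + 2)) - ω (dyadicPoint hT k (i + 1))|} with hE
  have hone : ∀ k i, μ (E k i)
      ≤ ENNReal.ofReal (C * (2 * (T / 2 ^ k)) ^ (1 + r) / (θ ^ k) ^ (p + q)) := fun k i => by
    refine measure_two_increments_gt_le hp hq (by positivity)
      ((h _ _ _ (dyadicPoint_mono hT k (by omega)) (dyadicPoint_mono hT k (by omega))).trans ?_)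
    have := abs_dyadicPoint_sub_le hT k i 2
    push_cast at this
    gcongr
  have hlevel : ∀ k, μ (⋃ i ∈ Finset.range (2 ^ k), E k i)
      ≤ ENNReal.ofReal (C * (2 * T) ^ (1 + r) * ρ ^ k) := fun k => by
    refine (measure_biUnion_finset_le _ _).trans
      ((Finset.sum_le_sum fun i _ => hone k i).trans (le_of_eq ?_))
    rw [Finset.sum_const, Finset.card_range, nsmul_eq_mul, ← ENNReal.ofReal_natCast,
      ← ENNReal.ofReal_mul (by positivity)]
    congr 1
    have e1 : (2 * (T / 2 ^ k)) ^ (1 + r) = (2 * T) ^ (1 + r) / (2 ^ k * (2 ^ k) ^ r) := by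
      rw [← mul_div_assoc, Real.div_rpow (by positivity) (by positivity),
        Real.rpow_add (x := (2 : ℝ) ^ k) (by positivity), Real.rpow_one]
    have e2 : ρ ^ k = ((2 ^ k) ^ r * (θ ^ k) ^ (p + q))⁻¹ := by
      rw [hρ, inv_pow, mul_pow, Real.rpow_pow_comm (by positivity), Real.rpow_pow_comm hθ.le]
    rw [e1, e2]
    push_cast
    field_simp
  calc μ {ω | ∃ k, K ≤ k ∧ ∃ i, ω ∈ E k i}
      ≤ μ (⋃ j : ℕ, ⋃ i ∈ Finset.range (2 ^ (K + j)), E (K + j) i) := by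
        refine measure_mono ?_
        rintro ω ⟨k, hk, i, hi⟩
        simp only [mem_iUnion]
        refine ⟨k - K, i, ?_, ?_⟩
        · -- beyond the index `2 ^ k` all grid points coincide, so the second increment vanishes
          rw [Nat.add_sub_cancel' hk, Finset.mem_range]
          by_contra! hle
          have := hi.2
          rw [dyadicPoint_eq_of_le hT (show 2 ^ k ≤ i + 2 by omega)
            (show 2 ^ k ≤ i + 1 by omega), sub_self, abs_zero] at this
          exact not_lt.2 (by positivity) this
        · rwa [Nat.add_sub_cancel' hk]
    _ ≤ ∑' j : ℕ, μ (⋃ i ∈ Finset.range (2 ^ (K + j)), E (K + j) i) := measure_iUnion_le _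
    _ ≤ ∑' j : ℕ, ENNReal.ofReal (C * (2 * T) ^ (1 + r) * ρ ^ K * ρ ^ j) :=
        ENNReal.tsum_le_tsum fun j => (hlevel (K + j)).trans (le_of_eq (by rw [pow_add, ← mul_assoc]))
    _ = ENNReal.ofReal (∑' j : ℕ, C * (2 * T) ^ (1 + r) * ρ ^ K * ρ ^ j) :=
        (ENNReal.ofReal_tsum_of_nonneg (fun j => by positivity)
          ((summable_geometric_of_lt_one hρ0.le hρ1).mul_left _)).symm
    _ = _ := by
        rw [tsum_mul_left, tsum_geometric_of_lt_one hρ0.le hρ1]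
        congr 1
        rw [div_eq_mul_inv]
        ring

end Increments

/-! ### Tightness -/

/-- The moment bounds give, uniformly over the measures that satisfy them, a finite set of paths
whose `η`-neighbourhood has almost full measure. -/
theorem exists_finite_forall_measure_le {T : ℝ} (hT : 0 < T) {S : Set (Measure (CadlagPath T))}
    {C₁ a : ℝ} (hC₁ : 0 < C₁) (ha : 0 < a)
    (h_i : ∀ μ ∈ S, ∀ s t : Icc (0 : ℝ) T,
      ∫⁻ ω, ENNReal.ofReal |ω t - ω s| ∂μ ≤ ENNReal.ofReal (C₁ * |(t : ℝ) - (s : ℝ)| ^ a))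
    {C₂ r p q : ℝ} (hC₂ : 0 < C₂) (hr : 0 < r) (hp : 0 ≤ p) (hq : 0 ≤ q) (hpq : 0 < p + q)
    (h_ii : ∀ μ ∈ S, ∀ s u t : Icc (0 : ℝ) T, s ≤ u → u ≤ t →
      ∫⁻ ω, ENNReal.ofReal (|ω t - ω u| ^ p * |ω u - ω s| ^ q) ∂μ
        ≤ ENNReal.ofReal (C₂ * |(t : ℝ) - (s : ℝ)| ^ (1 + r)))
    {η α : ℝ} (hη : 0 < η) (hα : 0 < α) :
    ∃ F : Set (CadlagPath T), F.Finite ∧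
      ∀ μ ∈ S, μ {x | ∀ y ∈ F, ¬ edist x y ≤ ENNReal.ofReal η} ≤ ENNReal.ofReal α := by
  -- with this `θ` the ratio of the geometric series in the union bound is `2 ^ (-r / 2)`
  set θ : ℝ := 2 ^ (-(r / (2 * (p + q)))) with hθ
  have hθ0 : 0 < θ := by positivity
  have hθ1 : θ < 1 := Real.rpow_lt_one_of_one_lt_of_neg (by norm_num) (by
    have : 0 < r / (2 * (p + q)) := by positivity
    linarith)
  have hθr : 1 < 2 ^ r * θ ^ (p + q) := by
    rw [hθ, ← Real.rpow_mul (by norm_num), ← Real.rpow_add (by norm_num)]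
    refine Real.one_lt_rpow (by norm_num) ?_
    have : -(r / (2 * (p + q))) * (p + q) = -(r / 2) := by field_simp
    rw [this]
    linarith
  set ρ : ℝ := (2 ^ r * θ ^ (p + q))⁻¹ with hρ
  have hρ0 : 0 < ρ := by positivity
  have hρ1 : ρ < 1 := inv_lt_one_of_one_lt₀ hθr
  have lim1 : Tendsto (fun K : ℕ => (1 - θ)⁻¹ * θ ^ K) atTop (𝓝 0) := by
    simpa using (tendsto_pow_atTop_nhds_zero_of_lt_one hθ0.le hθ1).const_mul (1 - θ)⁻¹
  have lim2 : Tendsto (fun K : ℕ => C₂ * (2 * T) ^ (1 + r) / (1 - ρ) * ρ ^ K) atTop (𝓝 0) := by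
    simpa using (tendsto_pow_atTop_nhds_zero_of_lt_one hρ0.le hρ1).const_mul
      (C₂ * (2 * T) ^ (1 + r) / (1 - ρ))
  have lim3 : Tendsto (fun K : ℕ => C₁ * (T / 2 ^ K) ^ a / (η / 12)) atTop (𝓝 0) := by
    have h1 : Tendsto (fun K : ℕ => T / 2 ^ K) atTop (𝓝 0) :=
      tendsto_const_nhds.div_atTop (tendsto_pow_atTop_atTop_of_one_lt (by norm_num))
    have h2 := ((h1.rpow_const (Or.inr ha.le)).const_mul C₁).div_const (η / 12)
    simpa [Real.zero_rpow ha.ne'] using h2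
  obtain ⟨K, ⟨hK1, hK2⟩, hK3⟩ := (((lim1.eventually_le_const (show 0 < η / 24 by positivity)).and
    (lim2.eventually_le_const (show 0 < α / 4 by positivity))).and
    (lim3.eventually_le_const (show 0 < α / 4 by positivity))).exists
  have h1θ : 0 < 1 - θ := by linarith
  have hθK : θ ^ K ≤ η / 24 := by
    refine le_trans ?_ hK1
    exact le_mul_of_one_le_left (by positivity) ((one_le_inv₀ h1θ).2 (by linarith))
  have hsum : ∀ n, ∑ m ∈ Finset.range n, θ ^ (K + m + 1) ≤ η / 24 := fun n => by
    calc ∑ m ∈ Finset.range n, θ ^ (K + m + 1) ≤ ∑ m ∈ Finset.range n, θ ^ K * θ ^ m :=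
          Finset.sum_le_sum fun m _ => by
            rw [← pow_add]
            exact pow_le_pow_of_le_one hθ0.le hθ1.le (by omega)
      _ = θ ^ K * ∑ m ∈ Finset.range n, θ ^ m := by rw [Finset.mul_sum]
      _ ≤ θ ^ K * (1 - θ)⁻¹ := by
          gcongr
          rw [← tsum_geometric_of_lt_one hθ0.le hθ1]
          exact (summable_geometric_of_lt_one hθ0.le hθ1).sum_le_tsum _ fun _ _ => by positivity
      _ ≤ η / 24 := by rwa [mul_comm]
  -- `M` is such that the union bound over the `2 ^ K + 1` grid points amounts to `α / 4`
  set M : ℝ := (2 ^ K + 1) * (C₁ * T ^ a) / (α / 4) with hM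
  have hM0 : 0 < M := by positivity
  obtain ⟨F, hF, hFnet⟩ := CadlagPath.exists_finite_net hT
    (show 0 < T / 2 ^ K / 2 by positivity) hη (M + η / 24)
  refine ⟨F, hF, fun μ hμ => ?_⟩
  let g := dyadicPoint hT.le
  set E₁ : Set (CadlagPath T) := {ω | ∃ k, K ≤ k ∧ ∃ i,
    θ ^ k < |ω (g k (i + 1)) - ω (g k i)| ∧ θ ^ k < |ω (g k (i + 2)) - ω (g k (i + 1))|} with hE₁
  set E₂ : ℕ → Set (CadlagPath T) := fun i => {ω | η / 12 < |ω (g K (i + 1)) - ω (g K i)|} with hE₂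
  set E₃ : Set (CadlagPath T) :=
    ⋃ i ∈ Finset.range (2 ^ K + 1), {ω | M < |ω (g K i) - ω (g K 0)|} with hE₃
  have hb₁ : μ E₁ ≤ ENNReal.ofReal (α / 4) :=
    (measure_exists_dyadic_increments_gt_le hT.le hC₂.le hr hp hq hθ0 hθr (h_ii μ hμ) K).trans
      (ENNReal.ofReal_le_ofReal hK2)
  have hb₂ : ∀ i, μ (E₂ i) ≤ ENNReal.ofReal (α / 4) := fun i => by
    refine (measure_increment_gt_le (by positivity) ((h_i μ hμ _ _).trans
      (ENNReal.ofReal_le_ofReal ?_))).trans (ENNReal.ofReal_le_ofReal hK3)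
    have := abs_dyadicPoint_sub_le hT.le K i 1
    rw [Nat.cast_one, one_mul] at this
    gcongr
  have hb₃ : μ E₃ ≤ ENNReal.ofReal (α / 4) := by
    have h1 : ∀ i, μ {ω | M < |ω (g K i) - ω (g K 0)|} ≤ ENNReal.ofReal (C₁ * T ^ a / M) :=
      fun i => by
        refine measure_increment_gt_le hM0 ((h_i μ hμ _ _).trans (ENNReal.ofReal_le_ofReal ?_))
        have h2 : |(g K i : ℝ) - g K 0| ≤ T := by
          simp only [g]
          rw [dyadicPoint_zero, sub_zero, abs_of_nonneg (dyadicPoint hT.le K i).2.1]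
          exact (dyadicPoint hT.le K i).2.2
        gcongr
    refine (measure_biUnion_finset_le _ _).trans ((Finset.sum_le_sum fun i _ => h1 i).trans
      (le_of_eq ?_))
    rw [Finset.sum_const, Finset.card_range, nsmul_eq_mul, ← ENNReal.ofReal_natCast,
      ← ENNReal.ofReal_mul (by positivity)]
    congr 1
    rw [hM]
    push_cast
    field_simp
  have hsub : {x | ∀ y ∈ F, ¬ edist x y ≤ ENNReal.ofReal η}
      ⊆ E₁ ∪ (E₂ 0 ∪ (E₂ (2 ^ K - 1) ∪ E₃)) := by
    intro x hx
    by_contra hcon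
    simp only [mem_union, not_or] at hcon
    obtain ⟨h1, h2, h3, h4⟩ := hcon
    simp only [hE₁, mem_ofPred_eq, not_exists, not_and, not_lt] at h1
    simp only [hE₂, mem_ofPred_eq, not_lt] at h2 h3
    simp only [hE₃, mem_iUnion, mem_ofPred_eq, not_exists, not_lt, Finset.mem_range] at h4
    obtain ⟨hpart, hbound⟩ := x.hasSparsePartition_of_dyadic hT (ε := fun k => θ ^ k)
      (e := η / 12) (c := η / 24) (K := K) (fun k => by positivity) (by linarith) hsum
      (fun k hk i => or_iff_not_imp_left.2 fun h => h1 k hk i (not_le.1 h)) h2 h3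
    have hη' : 3 * (2 * (η / 24) + η / 12) = η / 2 := by ring
    rw [hη'] at hpart
    obtain ⟨y, hy, hxy⟩ := hFnet x hpart (hbound M fun i hi => by
      have := h4 i (by omega)
      rwa [x.map_zero _ (dyadicPoint_zero hT.le K), sub_zero] at this)
    exact hx y hy hxy
  calc μ {x | ∀ y ∈ F, ¬ edist x y ≤ ENNReal.ofReal η}
      ≤ μ (E₁ ∪ (E₂ 0 ∪ (E₂ (2 ^ K - 1) ∪ E₃))) := measure_mono hsub
    _ ≤ μ E₁ + (μ (E₂ 0) + (μ (E₂ (2 ^ K - 1)) + μ E₃)) :=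
        (measure_union_le _ _).trans (add_le_add_right ((measure_union_le _ _).trans
          (add_le_add_right (measure_union_le _ _) _)) _)
    _ ≤ ENNReal.ofReal (α / 4) + (ENNReal.ofReal (α / 4)
          + (ENNReal.ofReal (α / 4) + ENNReal.ofReal (α / 4))) :=
        add_le_add hb₁ (add_le_add (hb₂ _) (add_le_add (hb₂ _) hb₃))
    _ = ENNReal.ofReal α := by
        rw [← ENNReal.ofReal_add (by positivity) (by positivity),
          ← ENNReal.ofReal_add (by positivity) (by positivity),
          ← ENNReal.ofReal_add (by positivity) (by positivity)]
        congr 1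
        ring

theorem mainTheorem8 (T : ℝ) (hT : 0 ≤ T) (Q : Set (ProbabilityMeasure (CadlagPath T)))
    (C₁ a : ℝ) (hC₁ : 0 < C₁) (ha : 0 < a)
    (h_i : ∀ s t : Icc (0 : ℝ) T,
      upperExpectation Q (fun ω => ENNReal.ofReal |ω t - ω s|)
        ≤ ENNReal.ofReal (C₁ * |(t : ℝ) - (s : ℝ)| ^ a))
    (C₂ r p q : ℝ) (hC₂ : 0 < C₂) (hr : 0 < r) (hp : 0 ≤ p) (hq : 0 ≤ q) (hpq : 0 < p + q)
    (h_ii : ∀ s u t : Icc (0 : ℝ) T, s ≤ u → u ≤ t →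
      upperExpectation Q (fun ω => ENNReal.ofReal (|ω t - ω u| ^ p * |ω u - ω s| ^ q))
        ≤ ENNReal.ofReal (C₂ * |(t : ℝ) - (s : ℝ)| ^ (1 + r))) :
    WeaklyRelativelyCompact Q := by
  refine isCompact_closure_of_isTightMeasureSet ?_
  rcases hT.eq_or_lt with rfl | hT0
  · -- the only path on `[0, 0]` is `0`
    have hsub : Subsingleton (CadlagPath 0) := ⟨fun x y => CadlagPath.ext_toFun fun t => by
      have ht : (t : ℝ) = 0 := le_antisymm t.2.2 t.2.1
      rw [x.map_zero t ht, y.map_zero t ht]⟩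
    exact IsTightMeasureSet.of_compactSpace
  · refine isTightMeasureSet_of_forall_exists_finite fun η hη α hα =>
      exists_finite_forall_measure_le hT0 hC₁ ha ?_ hC₂ hr hp hq hpq ?_ hη hα
    · rintro _ ⟨P, hP, rfl⟩ s t
      exact lintegral_le_of_upperExpectation_le (h_i s t) hP
    · rintro _ ⟨P, hP, rfl⟩ s u t hsu hut
      exact lintegral_le_of_upperExpectation_le (h_ii s u t hsu hut) hP
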